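/- Let $H$ be a complex Hilbert space with a fixed orthonormal basis $\{e_n\}_{n\in\mathbb N}$ (so $H$ is separable and infinite dimensional). Let $\mathcal D$ be the algebra of bounded operators that are diagonal with respect to this basis, $\mathcal K$ the ideal of compact operators, and $\mathcal D+\mathcal K=\{D+K : D\in\mathcal D,\ K\in\mathcal K\}$. Let $\mathcal P_{\mathcal D+\mathcal K}$ be the set of orthogonal projections in $\mathcal D+\mathcal K$, and $\mathcal P^\infty_{\mathcal D+\mathcal K}$ the subset of those that have infinite rank and infinite co-rank, both with the operator norm topology. For orthogonal projections $P,Q$ such that the operator $Q|_{R(P)}:R(P)\to R(Q)$ is Fredholm, let $\mathrm{index}(P,Q)$ be its Fredholm index, i.e. the dimension of its kernel minus the dimension of its cokernel; the equation $\mathrm{index}(P,Q)=0$ includes the assertion that this operator is Fredholm. Put $U_\infty(H)=\{e^{iX} : X=X^*\in\mathcal K\}$. Then: 1. $U_\infty(H)$ is a subgroup of the unitary group of $H$, and the connected components of $\mathcal P^\infty_{\mathcal D+\mathcal K}$ are the orbits of its action by conjugation: for every $P\in\mathcal P^\infty_{\mathcal D+\mathcal K}$, the connected component of $P$ in $\mathcal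 P^\infty_{\mathcal D+\mathcal K}$ is $\{UPU^* : U\in U_\infty(H)\}$. 2. The connected components of $\mathcal P^\infty_{\mathcal D+\mathcal K}$ are parametrized by the diagonal projections with infinitely many $0$'s and infinitely many $1$'s on the diagonal, modulo the relation $\mathrm{index}(E,E')=0$: each such diagonal projection lies in $\mathcal P^\infty_{\mathcal D+\mathcal K}$, every connected component of $\mathcal P^\infty_{\mathcal D+\mathcal K}$ contains such a projection, and two such projections $E,E'$ lie in the same component if and only if $\mathrm{index}(E,E')=0$. 3. In particular, $\mathcal P^\infty_{\mathcal D+\mathcal K}$ has uncountably many connected components, and so has $\mathcal P_{\mathcal D+\mathcal K}$. -/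

import Mathlib

noncomputable section

namespace DiagPlusCompact

/-! ### Fredholm index and the index of a pair of projections -/

section Index

variable {E F : Type*} [NormedAddCommGroup E] [NormedSpace ℂ E]
  [NormedAddCommGroup F] [NormedSpace ℂ F]

/-- The index `dim ker T - dim coker T` of a bounded operator; it is meaningful when `T` is
Fredholm, and is only used together with `T.IsFredholm`. -/
def fredholmIndex (T : E →L[ℂ] F) : ℤ :=
  (Module.finrank ℂ (LinearMap.ker T.toLinearMap) : ℤ)
    - (Module.finrank ℂ (F ⧸ LinearMap.range T.toLinearMap) : ℤ)

/-- The operator `Q|_{R(P)} : R(P) → R(Q)`. -/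
def pairOperator (P Q : E →L[ℂ] E) :
    LinearMap.range P.toLinearMap →L[ℂ] LinearMap.range Q.toLinearMap :=
  (Q.comp (LinearMap.range P.toLinearMap).subtypeL).codRestrict
    (LinearMap.range Q.toLinearMap) (fun x => ⟨(x : E), rfl⟩)

/-- The index of the pair of projections `(P, Q)` is defined and equal to `n`:
the operator `Q|_{R(P)} : R(P) → R(Q)` is Fredholm, and its Fredholm index is `n`. -/
def HasPairIndex (P Q : E →L[ℂ] E) (n : ℤ) : Prop :=
  (pairOperator P Q).IsFredholm ∧ fredholmIndex (pairOperator P Q) = n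

end Index

/-! ### The algebra of diagonal plus compact operators and its projections -/

variable {H : Type*} [NormedAddCommGroup H] [InnerProductSpace ℂ H]

/-- `T` is diagonal with respect to the orthonormal basis `b`. -/
def IsDiagonal (b : HilbertBasis ℕ ℂ H) (T : H →L[ℂ] H) : Prop :=
  ∃ d : ℕ → ℂ, ∀ n, T (b n) = d n • b n

/-- The set `D + K` of all sums of a diagonal operator and a compact operator. -/
def diagPlusCompact (b : HilbertBasis ℕ ℂ H) : Set (H →L[ℂ] H) :=
  {T | ∃ D K : H →L[ℂ] H, IsDiagonal b D ∧ IsCompactOperator K ∧ T = D + K}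

variable [CompleteSpace H]

/-- The orthogonal projections in `D + K`. -/
def projections (b : HilbertBasis ℕ ℂ H) : Set (H →L[ℂ] H) :=
  {P | IsStarProjection P ∧ P ∈ diagPlusCompact b}

/-- The orthogonal projections in `D + K` that have infinite rank and infinite co-rank. -/
def infProjections (b : HilbertBasis ℕ ℂ H) : Set (H →L[ℂ] H) :=
  {P | P ∈ projections b ∧
    ¬ FiniteDimensional ℂ (LinearMap.range P.toLinearMap) ∧
    ¬ FiniteDimensional ℂ (LinearMap.ker P.toLinearMap)}

/-- The diagonal projections with infinitely many `1`'s and infinitely many `0`'s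
on the diagonal. -/
def infDiagProjections (b : HilbertBasis ℕ ℂ H) : Set (H →L[ℂ] H) :=
  {E | IsStarProjection E ∧ IsDiagonal b E ∧
    {n | E (b n) = b n}.Infinite ∧ {n | E (b n) = 0}.Infinite}

variable (H) in
/-- `U_∞(H)`, the set of all `e^{iX}` with `X` self-adjoint and compact. -/
def compactExp : Set (H →L[ℂ] H) :=
  {U | ∃ X : H →L[ℂ] H, IsSelfAdjoint X ∧ IsCompactOperator X ∧
    U = NormedSpace.exp (Complex.I • X)}

/-- The orbit of `P` under conjugation by the elements of `U_∞(H)`. -/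
def compactExpOrbit (P : H →L[ℂ] H) : Set (H →L[ℂ] H) :=
  {Q | ∃ U ∈ compactExp H, Q = U * P * star U}

/-- The connected components of a subset of a topological space, as a set of subsets. -/
def componentsOf {X : Type*} [TopologicalSpace X] (S : Set X) : Set (Set X) :=
  (fun x => connectedComponentIn S x) '' S

end DiagPlusCompact

end

/-! Everything reduces to one relation, `CompactEquiv`: conjugacy of projections by a unitary `U`
with `U - 1` compact. On a separable space these unitaries are exactly the elements of `U_∞(H)`.
Such a unitary has countable spectrum, so a branch of the logarithm can be chosen whose cut misses
it (`exists_exp_eq_of_unitary`).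

Orbits are connected, by the path `exp(itX) P exp(-itX)`. Conversely, the classes of `CompactEquiv`
are relatively open. If `P`, `Q` in `D + K` have distance less than one, comparing them on basis
vectors with nearby diagonal projections shows that `P - Q` is compact
(`isCompactOperator_sub_of_norm_lt_one`). The unitary part of `QP + (1 - Q)(1 - P)` then conjugates
`P` to `Q` (`compactEquiv_of_norm_sub_lt_one`). So components and orbits agree.

Every infinite projection is a compact perturbation of some diagonal `diagProj b B`. The obstruction
to conjugacy is the finite difference between the dimensions of `R(P) ∩ N(E)` and `R(E) ∩ N(P)`, and
changing finitely many entries of `E` removes it (`exists_compactEquiv_diagProj`). For diagonal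
projections, conjugacy means that `A \ B` and `B \ A` are finite of equal size
(`compactEquiv_diagProj_iff`); these sizes are the kernel and cokernel dimensions in the pair index.
Since each class contains countably many diagonal projections, there are uncountably many classes.
-/

noncomputable section

namespace DiagPlusCompact

open Filter Topology

/-! ### Unitaries that are compact perturbations of the identity -/

section

variable {H : Type*} [NormedAddCommGroup H] [InnerProductSpace ℂ H]

theorem isCompactOperator_mul_left {K : H →L[ℂ] H} (hK : IsCompactOperator K) (T : H →L[ℂ] H) :
    IsCompactOperator (T * K) :=
  hK.clm_comp T

theorem isCompactOperator_mul_right {K : H →L[ℂ] H} (hK : IsCompactOperator K) (T : H →L[ℂ] H) :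
    IsCompactOperator (K * T) :=
  hK.comp_clm T

variable [CompleteSpace H]

/-- Without its constant term, every term of the exponential series has a factor `X`, and norm
limits of compact operators are compact. -/
theorem isCompactOperator_exp_sub_one {X : H →L[ℂ] H} (hX : IsCompactOperator X) :
    IsCompactOperator (NormedSpace.exp X - 1 : H →L[ℂ] H) := by
  have h := NormedSpace.exp_series_hasSum_exp' (𝕂 := ℂ) X
  have h' := ((hasSum_nat_add_iff' 1).2 h).tendsto_sum_nat
  simp only [Finset.range_one, Finset.sum_singleton, Nat.factorial_zero, Nat.cast_one, inv_one,
    pow_zero, one_smul] at h'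
  refine isCompactOperator_of_tendsto h' (Eventually.of_forall fun n => ?_)
  refine (compactOperator (RingHom.id ℂ) H H).sum_mem fun k _ => ?_
  refine (compactOperator (RingHom.id ℂ) H H).smul_mem _ ?_
  rw [pow_succ]
  exact isCompactOperator_mul_left hX _

/-- A compact perturbation of the identity that is injective is invertible. -/
theorem isUnit_of_isCompactOperator_sub_one {S : H →L[ℂ] H}
    (hS : IsCompactOperator (S - 1 : H →L[ℂ] H)) (hinj : ∀ x, S x = 0 → x = 0) : IsUnit S := by
  have hne : (-1 : ℂ) ≠ 0 := by norm_num
  rcases hS.hasEigenvalue_or_mem_resolventSet hne with h | h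
  · obtain ⟨x, hx⟩ := h.exists_hasEigenvector
    have h1 := hx.apply_eq_smul
    have : S x = 0 := by
      have : S x - x = -x := by simpa using h1
      simpa using this
    exact absurd (hinj x this) hx.2
  · rw [spectrum.mem_resolventSet_iff, ← IsUnit.neg_iff] at h
    convert h using 1
    simp

/-- The Fredholm alternative for `U - 1` at the nonzero value `z - 1`. -/
theorem apply_eq_of_mem_spectrum {U : H →L[ℂ] H} (hc : IsCompactOperator (U - 1 : H →L[ℂ] H))
    {z : ℂ} (hz : z ∈ spectrum ℂ U) (hz1 : z ≠ 1) : ∃ x, ‖x‖ = 1 ∧ U x = z • x := by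
  have hne : z - 1 ≠ 0 := sub_ne_zero.2 hz1
  rcases hc.hasEigenvalue_or_mem_resolventSet hne with h | h
  · obtain ⟨x, hx⟩ := h.exists_hasEigenvector
    have h1 := hx.apply_eq_smul
    have h2 : U x = z • x := by
      have : U x - x = z • x - x := by simpa [sub_smul] using h1
      simpa using this
    have hx0 : x ≠ 0 := hx.2
    refine ⟨((‖x‖⁻¹ : ℝ) : ℂ) • x, ?_, ?_⟩
    · rw [norm_smul]; simp [hx0]
    · rw [map_smul, h2, smul_comm]
  · exfalso
    rw [spectrum.mem_resolventSet_iff] at h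
    rw [spectrum.mem_iff] at hz
    apply hz
    convert h using 1
    simp

/-- Unit eigenvectors of a unitary for distinct eigenvalues are orthogonal, hence at distance `√2`.
The balls of radius `1/2` around them are disjoint, and separability allows only countably many. -/
theorem countable_spectrum_of_unitary [TopologicalSpace.SeparableSpace H] {U : H →L[ℂ] H}
    (hU : U ∈ unitary (H →L[ℂ] H)) (hc : IsCompactOperator (U - 1 : H →L[ℂ] H)) :
    (spectrum ℂ U).Countable := by
  have key : (spectrum ℂ U \ {1}).Countable := by
    have : ∀ z : ℂ, ∃ x : H, z ∈ spectrum ℂ U \ {1} → ‖x‖ = 1 ∧ U x = z • x := by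
      intro z
      by_cases hz : z ∈ spectrum ℂ U \ {1}
      · obtain ⟨x, hx⟩ := apply_eq_of_mem_spectrum hc hz.1 hz.2
        exact ⟨x, fun _ => hx⟩
      · exact ⟨0, fun h => absurd h hz⟩
    choose v hv using this
    refine Set.PairwiseDisjoint.countable_of_isOpen (s := fun z => Metric.ball (v z) (1 / 2)) ?_
      (fun z _ => Metric.isOpen_ball) (fun z _ => ⟨v z, by simp⟩)
    intro z hz w hw hzw
    refine Metric.ball_disjoint_ball ?_
    have horth : inner ℂ (v z) (v w) = 0 := by
      have h1 := ContinuousLinearMap.inner_map_map_of_mem_unitary hU (v z) (v w)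
      rw [(hv z hz).2, (hv w hw).2, inner_smul_left, inner_smul_right, ← mul_assoc] at h1
      have hz1 : ‖z‖ = 1 := spectrum.norm_eq_one_of_unitary hU hz.1
      by_contra hne
      have h2 : (starRingEnd ℂ) z * w = 1 := by
        apply mul_right_cancel₀ hne; rw [h1, one_mul]
      apply hzw
      have h3 : z * (starRingEnd ℂ) z = 1 := by rw [Complex.mul_conj']; simp [hz1]
      calc z = z * ((starRingEnd ℂ) z * w) := by rw [h2, mul_one]
        _ = w := by rw [← mul_assoc, h3, one_mul]
    have h4 : ‖v z - v w‖ * ‖v z - v w‖ = 2 := by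
      have h5 := norm_sub_sq (𝕜 := ℂ) (v z) (v w)
      rw [horth, (hv z hz).1, (hv w hw).1] at h5
      simp at h5; nlinarith
    rw [dist_eq_norm]
    nlinarith [norm_nonneg (v z - v w)]
  exact (key.union (Set.countable_singleton 1)).mono (by intro z hz; by_cases h : z = 1 <;> simp [h, hz])

theorem exists_norm_one_notMem_of_countable {s : Set ℂ} (hs : s.Countable) :
    ∃ c : ℂ, ‖c‖ = 1 ∧ c ∉ s := by
  have h1 : (Set.Ioo (0 : ℝ) 1 ∩ (fun t : ℝ => (Circle.exp t : ℂ)) ⁻¹' s).Countable := by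
    refine Set.MapsTo.countable_of_injOn (f := fun t : ℝ => (Circle.exp t : ℂ)) (t := s)
      (fun t ht => ht.2) ?_ hs
    intro x hx y hy hxy
    have h : Circle.exp x = Circle.exp y := Subtype.ext hxy
    have hpi := Real.pi_gt_three
    rw [← Circle.arg_exp (x := x) (by linarith [hx.1.1]) (by linarith [hx.1.2]), h,
      Circle.arg_exp (x := y) (by linarith [hy.1.1]) (by linarith [hy.1.2])]
  obtain ⟨t, ht, ht'⟩ := (h1.dense_compl ℝ).inter_open_nonempty (Set.Ioo (0 : ℝ) 1) isOpen_Ioo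
    ⟨1 / 2, by norm_num⟩
  exact ⟨Circle.exp t, by simp, fun h => ht' ⟨ht, h⟩⟩

/-- With `f(z) = -i log(zw)` holomorphic around the spectrum and `1`, take `X = f(U) - f(1)`. On the
unit circle `f` is a real argument, so `X` is self-adjoint; subtracting `f(1)` makes `z - 1` a
factor, so `X` is compact. -/
theorem exists_exp_eq_of_unitary [TopologicalSpace.SeparableSpace H] {U : H →L[ℂ] H}
    (hU : U ∈ unitary (H →L[ℂ] H)) (hc : IsCompactOperator (U - 1 : H →L[ℂ] H)) :
    ∃ X : H →L[ℂ] H, IsSelfAdjoint X ∧ IsCompactOperator X ∧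
      U = NormedSpace.exp (Complex.I • X) := by
  obtain ⟨c, hc1, hcs⟩ := exists_norm_one_notMem_of_countable
    ((countable_spectrum_of_unitary hU hc).union (Set.countable_singleton 1))
  have hc0 : c ≠ 0 := by rintro rfl; simp at hc1
  -- Multiplication by `w` rotates `c`, which is neither in the spectrum nor equal to `1`, to `-1`
  -- on the cut of `log`.
  set w : ℂ := -c⁻¹ with hw
  have hw1 : ‖w‖ = 1 := by simp [hw, hc1]
  have hw0 : w ≠ 0 := by rintro h; rw [h] at hw1; simp at hw1
  have hslit : ∀ z : ℂ, ‖z‖ = 1 → z ≠ c → z * w ∈ Complex.slitPlane := by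
    intro z hz hzc
    rw [Complex.mem_slitPlane_iff_not_le_zero]
    intro hle
    have hn : ‖z * w‖ = 1 := by simp [hz, hw1]
    have : z * w = -1 := by
      obtain ⟨h1, h2⟩ := Complex.le_def.1 hle
      have h3 := Complex.sq_norm_sub_sq_re (z * w)
      rw [hn, h2] at h3
      simp only [Complex.zero_re, Complex.zero_im] at h1 h3
      apply Complex.ext
      · simp only [Complex.neg_re, Complex.one_re]; nlinarith
      · rw [h2]; simp
    apply hzc
    rw [hw] at this
    field_simp at this
    exact neg_injective this
  have hspec : ∀ z ∈ spectrum ℂ U, ‖z‖ = 1 ∧ z * w ∈ Complex.slitPlane := fun z hz =>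
    ⟨spectrum.norm_eq_one_of_unitary hU hz,
      hslit z (spectrum.norm_eq_one_of_unitary hU hz) (by rintro rfl; exact hcs (Or.inl hz))⟩
  have h1w : (1 : ℂ) * w ∈ Complex.slitPlane :=
    hslit 1 (by simp) (by rintro h; exact hcs (Or.inr h.symm))
  set f : ℂ → ℂ := fun z => -Complex.I * Complex.log (z * w) with hf
  have hfd : DifferentiableOn ℂ f {z | z * w ∈ Complex.slitPlane} := by
    intro z hz
    have : DifferentiableAt ℂ f z :=
      ((differentiableAt_id.mul_const w).clog hz).const_mul _
    exact this.differentiableWithinAt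
  have hopen : IsOpen {z : ℂ | z * w ∈ Complex.slitPlane} :=
    Complex.isOpen_slitPlane.preimage (by fun_prop)
  have hnhds : {z : ℂ | z * w ∈ Complex.slitPlane} ∈ 𝓝 (1 : ℂ) := hopen.mem_nhds h1w
  -- The quotient `(f(z) - f(1)) / (z - 1)` extends continuously over `1`, so it can be applied to
  -- `U`.
  have hg : ContinuousOn (dslope f 1) (spectrum ℂ U) :=
    ((continuousOn_dslope hnhds).2 ⟨hfd.continuousOn, (hfd.differentiableAt hnhds)⟩).mono
      (fun z hz => (hspec z hz).2)
  have hfc : ContinuousOn (fun z => f z - f 1) (spectrum ℂ U) :=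
    (hfd.continuousOn.mono (fun z hz => (hspec z hz).2)).sub continuousOn_const
  have hN : IsStarNormal U := ⟨by rw [commute_iff_eq, (Unitary.mem_iff.1 hU).1, (Unitary.mem_iff.1 hU).2]⟩
  refine ⟨cfc (fun z => f z - f 1) U, ?_, ?_, ?_⟩
  · rw [IsSelfAdjoint, ← cfc_star]
    refine cfc_congr fun z hz => ?_
    have h1 : ∀ z : ℂ, ‖z‖ = 1 → f z = ((z * w).arg : ℂ) := by
      intro z hz
      have : Complex.log (z * w) = Complex.I * (z * w).arg := by
        apply Complex.ext <;> simp [Complex.log_re, Complex.log_im, hz, hw1]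
      simp [hf, this, ← mul_assoc]
    simp only [h1 z (hspec z hz).1, h1 1 (by simp)]
    simp
  · have : cfc (fun z => f z - f 1) U = (U - 1) * cfc (dslope f 1) U := by
      have h1 : U - 1 = cfc (fun z : ℂ => z - 1) U := by
        rw [cfc_sub .., cfc_id' ℂ U, cfc_const_one ℂ U]
      rw [h1, ← cfc_mul ..]
      refine cfc_congr fun z _ => ?_
      rw [← sub_smul_dslope, smul_eq_mul]
    rw [this]
    exact isCompactOperator_mul_right hc _
  · have hexp : Set.EqOn (fun z => Complex.exp (Complex.I • (f z - f 1))) (fun z => z) (spectrum ℂ U) := by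
      intro z hz
      have hz0 : z ≠ 0 := by rintro rfl; simpa using (hspec 0 hz).1
      have : Complex.I • (f z - f 1) = Complex.log (z * w) - Complex.log (1 * w) := by
        simp only [hf, smul_eq_mul]
        linear_combination (-Complex.log (z * w) + Complex.log (1 * w)) * Complex.I_mul_I
      simp only [this]
      rw [Complex.exp_sub, Complex.exp_log (mul_ne_zero hz0 hw0), Complex.exp_log (by simpa using hw0)]
      field_simp
    rw [← cfc_smul .., ← CFC.exp_eq_normedSpace_exp (𝕜 := ℂ), ← cfc_comp' ..]
    simp only [← Complex.exp_eq_exp_ℂ]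
    rw [cfc_congr hexp, cfc_id' ℂ U]

/-- The unitary operators that differ from the identity by a compact operator. -/
def compactUnitary (H : Type*) [NormedAddCommGroup H] [InnerProductSpace ℂ H] [CompleteSpace H] :
    Subgroup (unitary (H →L[ℂ] H)) where
  carrier := {U | IsCompactOperator ((U : H →L[ℂ] H) - 1 : H →L[ℂ] H)}
  one_mem' := by
    change IsCompactOperator _
    rw [OneMemClass.coe_one, sub_self]
    exact isCompactOperator_zero
  mul_mem' := by
    intro U V hU hV
    have : ((U * V : unitary (H →L[ℂ] H)) : H →L[ℂ] H) - 1
        = ((U : H →L[ℂ] H) - 1) * V + ((V : H →L[ℂ] H) - 1) := by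
      push_cast; noncomm_ring
    change IsCompactOperator _
    rw [this]
    exact (isCompactOperator_mul_right hU _).add hV
  inv_mem' := by
    intro U hU
    have : ((U⁻¹ : unitary (H →L[ℂ] H)) : H →L[ℂ] H) - 1
        = -(((U⁻¹ : unitary (H →L[ℂ] H)) : H →L[ℂ] H) * ((U : H →L[ℂ] H) - 1)) := by
      rw [mul_sub, ← Submonoid.coe_mul, inv_mul_cancel]; simp
    change IsCompactOperator _
    rw [this]
    exact (isCompactOperator_mul_left hU _).neg

theorem mem_compactUnitary {U : unitary (H →L[ℂ] H)} :
    U ∈ compactUnitary H ↔ IsCompactOperator ((U : H →L[ℂ] H) - 1 : H →L[ℂ] H) := Iff.rfl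

theorem exp_I_smul_mem_unitary {X : H →L[ℂ] H} (hX : IsSelfAdjoint X) :
    NormedSpace.exp (Complex.I • X) ∈ unitary (H →L[ℂ] H) :=
  (selfAdjoint.expUnitary ⟨X, hX⟩).2

theorem coe_image_compactUnitary [TopologicalSpace.SeparableSpace H] :
    (fun U : unitary (H →L[ℂ] H) => (U : H →L[ℂ] H)) '' (compactUnitary H : Set _)
      = compactExp H := by
  ext U
  constructor
  · rintro ⟨U, hU, rfl⟩
    exact exists_exp_eq_of_unitary U.2 hU
  · rintro ⟨X, hX, hXc, rfl⟩
    exact ⟨⟨_, exp_I_smul_mem_unitary hX⟩, isCompactOperator_exp_sub_one (hXc.smul Complex.I), rfl⟩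

end

/-! ### Conjugacy by compact perturbations of the identity -/

section

variable {H : Type*} [NormedAddCommGroup H] [InnerProductSpace ℂ H] [CompleteSpace H]

/-- Here `r = (S*S)^(-1/2)`. The commutation clause lets `U = S r` inherit intertwining relations
from `S`. -/
theorem exists_unitary_polar {S : H →L[ℂ] H} (hS : IsUnit S) (hn : S * star S = star S * S)
    (hc : IsCompactOperator (S - 1 : H →L[ℂ] H))
    (hRc : IsCompactOperator (1 - star S * S : H →L[ℂ] H)) :
    ∃ U ∈ compactUnitary H, ∃ r : H →L[ℂ] H, (U : H →L[ℂ] H) = S * r ∧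
      ∀ T, Commute (star S * S) T → Commute r T := by
  set R := star S * S with hR
  have hRsa : IsSelfAdjoint R := IsSelfAdjoint.star_mul_self S
  have hpos : ∀ x ∈ spectrum ℝ R, 0 < x := by
    intro x hx
    refine lt_of_le_of_ne (spectrum_nonneg_of_nonneg (star_mul_self_nonneg S) hx) ?_
    rintro rfl
    exact spectrum.zero_notMem ℝ (hS.star.mul hS) hx
  have hsq : ∀ x ∈ spectrum ℝ R, √x ≠ 0 := fun x hx => (Real.sqrt_pos.2 (hpos x hx)).ne'
  have hsq' : ∀ x ∈ spectrum ℝ R, √x * (1 + √x) ≠ 0 := fun x hx => by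
    have := Real.sqrt_pos.2 (hpos x hx)
    positivity
  have hcont : ContinuousOn (fun x : ℝ => (√x)⁻¹) (spectrum ℝ R) :=
    Real.continuous_sqrt.continuousOn.inv₀ hsq
  have hcont' : ContinuousOn (fun x : ℝ => (√x * (1 + √x))⁻¹) (spectrum ℝ R) :=
    (Continuous.continuousOn (by fun_prop)).inv₀ hsq'
  set r : H →L[ℂ] H := cfc (fun x : ℝ => (√x)⁻¹) R with hr
  have hcomm : ∀ T, Commute R T → Commute r T := fun T hT => hT.cfc_real _
  have hrsa : star r = r := (IsSelfAdjoint.cfc : IsSelfAdjoint r)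
  have hrr : r * r * R = 1 := by
    have : r * r * R = cfc (fun x : ℝ => (√x)⁻¹ * (√x)⁻¹ * x) R := by
      rw [cfc_mul (fun x : ℝ => (√x)⁻¹ * (√x)⁻¹) (fun x => x) R (hcont.mul hcont) continuousOn_id,
        cfc_mul (fun x : ℝ => (√x)⁻¹) (fun x : ℝ => (√x)⁻¹) R hcont hcont, cfc_id' ℝ R]
    rw [this, ← cfc_const_one ℝ R]
    refine cfc_congr fun x hx => ?_
    have h1 := hsq x hx
    have h2 := Real.mul_self_sqrt (hpos x hx).le
    field_simp
    nlinarith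
  -- From `1/√x - 1 = (1 - x) / (√x (1 + √x))`; the factor `1 - R` makes `r - 1` compact.
  have hr1 : r - 1 = (1 - R) * cfc (fun x : ℝ => (√x * (1 + √x))⁻¹) R := by
    have h1 : 1 - R = cfc (fun x : ℝ => 1 - x) R := by
      rw [cfc_sub (fun _ : ℝ => 1) (fun x => x) R continuousOn_const continuousOn_id,
        cfc_const_one ℝ R, cfc_id' ℝ R]
    have h2 : r - 1 = cfc (fun x : ℝ => (√x)⁻¹ - 1) R := by
      rw [cfc_sub (fun x : ℝ => (√x)⁻¹) (fun _ => 1) R hcont continuousOn_const, cfc_const_one ℝ R]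
    rw [h1, h2, ← cfc_mul (fun x : ℝ => 1 - x) (fun x : ℝ => (√x * (1 + √x))⁻¹) R
      (by fun_prop) hcont']
    refine cfc_congr fun x hx => ?_
    have h1 := Real.sqrt_pos.2 (hpos x hx)
    have h2 := Real.mul_self_sqrt (hpos x hx).le
    field_simp
    nlinarith
  have hSR : Commute R S := by
    rw [commute_iff_eq, hR, mul_assoc, ← mul_assoc S, hn, mul_assoc]
  have hrS := hcomm S hSR
  have hrR : Commute r R := hcomm R (Commute.refl R)
  have hU : S * r ∈ unitary (H →L[ℂ] H) := by
    rw [Unitary.mem_iff, star_mul, hrsa]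
    constructor
    · rw [mul_assoc, ← mul_assoc (star S), ← hR, ← hrR.eq, ← mul_assoc, hrr]
    · rw [mul_assoc, ← mul_assoc r, ← mul_assoc, (hrS.symm.mul_right hrS.symm).eq, mul_assoc, hn, hrr]
  refine ⟨⟨S * r, hU⟩, ?_, r, rfl, hcomm⟩
  rw [mem_compactUnitary]
  have : S * r - 1 = (S - 1) * r + (r - 1) := by noncomm_ring
  simp only [this]
  refine (isCompactOperator_mul_right hc _).add ?_
  rw [hr1]
  exact isCompactOperator_mul_right hRc _


/-- Conjugacy by a unitary operator that differs from the identity by a compact operator. -/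
def CompactEquiv (P Q : H →L[ℂ] H) : Prop :=
  ∃ U ∈ compactUnitary H, (U : H →L[ℂ] H) * P = Q * U

namespace CompactEquiv

theorem symm {P Q : H →L[ℂ] H} (h : CompactEquiv P Q) : CompactEquiv Q P := by
  obtain ⟨U, hU, h⟩ := h
  refine ⟨U⁻¹, inv_mem hU, ?_⟩
  have h1 : ((U⁻¹ : unitary (H →L[ℂ] H)) : H →L[ℂ] H) * U = 1 := by
    rw [← Submonoid.coe_mul, inv_mul_cancel]; rfl
  have h2 : (U : H →L[ℂ] H) * ((U⁻¹ : unitary (H →L[ℂ] H)) : H →L[ℂ] H) = 1 := by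
    rw [← Submonoid.coe_mul, mul_inv_cancel]; rfl
  calc _ = ((U⁻¹ : unitary (H →L[ℂ] H)) : H →L[ℂ] H) * (Q * U) *
        ((U⁻¹ : unitary (H →L[ℂ] H)) : H →L[ℂ] H) := by
        rw [mul_assoc, mul_assoc, h2, mul_one]
    _ = _ := by rw [← h, ← mul_assoc, h1, one_mul]

theorem trans {P Q R : H →L[ℂ] H} (h : CompactEquiv P Q) (h' : CompactEquiv Q R) :
    CompactEquiv P R := by
  obtain ⟨U, hU, h⟩ := h
  obtain ⟨V, hV, h'⟩ := h'
  refine ⟨V * U, mul_mem hV hU, ?_⟩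
  push_cast
  rw [mul_assoc, h, ← mul_assoc, h', mul_assoc]

theorem one_sub {P Q : H →L[ℂ] H} (h : CompactEquiv P Q) : CompactEquiv (1 - P) (1 - Q) := by
  obtain ⟨U, hU, h⟩ := h
  exact ⟨U, hU, by rw [mul_sub, sub_mul, h]; simp⟩

theorem isCompactOperator_sub {P Q : H →L[ℂ] H} (h : CompactEquiv P Q) :
    IsCompactOperator (P - Q : H →L[ℂ] H) := by
  obtain ⟨U, hU, h⟩ := h
  have : P - Q = Q * ((U : H →L[ℂ] H) - 1) - ((U : H →L[ℂ] H) - 1) * P := by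
    rw [mul_sub, sub_mul, h]; noncomm_ring
  rw [this]
  exact (isCompactOperator_mul_left hU _).sub (isCompactOperator_mul_right hU _)

end CompactEquiv

theorem mem_compactExpOrbit_iff [TopologicalSpace.SeparableSpace H] {P Q : H →L[ℂ] H} :
    Q ∈ compactExpOrbit P ↔ CompactEquiv P Q := by
  unfold compactExpOrbit
  rw [← coe_image_compactUnitary]
  constructor
  · rintro ⟨_, ⟨U, hU, rfl⟩, rfl⟩
    exact ⟨U, hU, by simp [mul_assoc]⟩
  · rintro ⟨U, hU, h⟩
    exact ⟨_, ⟨U, hU, rfl⟩, by simp [h, mul_assoc]⟩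

/-- Projections in general position whose difference is compact are conjugate. -/
theorem compactEquiv_of_trivial_intersection {P Q : H →L[ℂ] H} (hP : IsStarProjection P)
    (hQ : IsStarProjection Q) (hc : IsCompactOperator (P - Q : H →L[ℂ] H))
    (h1 : ∀ x, P x = x → Q x = 0 → x = 0) (h2 : ∀ x, P x = 0 → Q x = x → x = 0) :
    CompactEquiv P Q := by
  have hPP : P * P = P := hP.isIdempotentElem
  have hQQ : Q * Q = Q := hQ.isIdempotentElem
  have hPP' : ∀ T, P * (P * T) = P * T := fun T => by rw [← mul_assoc, hPP]
  have hQQ' : ∀ T, Q * (Q * T) = Q * T := fun T => by rw [← mul_assoc, hQQ]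
  have hPs : star P = P := hP.isSelfAdjoint
  have hQs : star Q = Q := hQ.isSelfAdjoint
  have hPx : ∀ x, P (P x) = P x := fun x => congr($hPP x)
  have hQx : ∀ x, Q (Q x) = Q x := fun x => congr($hQQ x)
  -- `S` satisfies `SP = QS`, and `S*S = SS* = 1 - (P - Q)²` commutes with `P`. Its kernel is
  -- trivial exactly because of `h1` and `h2`, so it is invertible as a compact perturbation of the
  -- identity.
  set S : H →L[ℂ] H := Q * P + (1 - Q) * (1 - P) with hS
  have hSs : star S = P * Q + (1 - P) * (1 - Q) := by simp [hS, hPs, hQs]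
  have hSc : IsCompactOperator (S - 1 : H →L[ℂ] H) := by
    have : S - 1 = Q * (P - Q) - (P - Q) * P := by
      simp only [hS, mul_sub, sub_mul, mul_one, one_mul, hPP, hQQ]; abel
    rw [this]
    exact (isCompactOperator_mul_left hc _).sub (isCompactOperator_mul_right hc _)
  have hR : star S * S = 1 - (P - Q) * (P - Q) := by
    rw [hSs, hS]
    simp only [mul_sub, sub_mul, mul_add, add_mul, mul_one, one_mul, mul_assoc, hPP, hQQ,
      hQQ']
    abel
  have hR' : S * star S = 1 - (P - Q) * (P - Q) := by
    rw [hSs, hS]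
    simp only [mul_sub, sub_mul, mul_add, add_mul, mul_one, one_mul, mul_assoc, hPP, hQQ,
      hPP']
    abel
  have hunit : IsUnit S := by
    refine isUnit_of_isCompactOperator_sub_one hSc fun x hx => ?_
    have hx' : Q (P x) + (x - P x - Q (x - P x)) = 0 := hx
    have ha : Q (P x) = 0 := by
      have := congrArg Q hx'
      simpa [hQx] using this
    have hb : P x = 0 := h1 _ (hPx x) ha
    have hd : Q x = x := by
      rw [hb] at hx'
      simpa [sub_eq_zero, eq_comm (a := x)] using hx'
    exact h2 x hb hd
  obtain ⟨U, hU, r, hUr, hcomm⟩ := exists_unitary_polar hunit (hR'.trans hR.symm) hSc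
    (by rw [hR, sub_sub_cancel]; exact isCompactOperator_mul_left hc _)
  refine ⟨U, hU, ?_⟩
  have hrP : Commute r P := by
    apply hcomm
    rw [commute_iff_eq, hR]
    simp only [mul_sub, sub_mul, mul_one, one_mul, mul_assoc, hPP, hPP', hQQ]
    abel
  have hSP : S * P = Q * S := by
    rw [hS]
    simp only [mul_sub, sub_mul, mul_add, add_mul, mul_one, one_mul, mul_assoc, hPP, hQQ,
      hQQ']
    abel
  rw [hUr, mul_assoc, hrP.eq, ← mul_assoc, hSP, mul_assoc]

/-- On `R(P) ∩ N(Q)` and `N(P) ∩ R(Q)` the operator `P - Q` acts as `1` and `-1`, which `‖P - Q‖ <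
1` forbids on nonzero vectors. -/
theorem compactEquiv_of_norm_sub_lt_one {P Q : H →L[ℂ] H} (hP : IsStarProjection P)
    (hQ : IsStarProjection Q) (hc : IsCompactOperator (P - Q : H →L[ℂ] H)) (h : ‖P - Q‖ < 1) :
    CompactEquiv P Q := by
  have key : ∀ x, ‖(P - Q) x‖ = ‖x‖ → x = 0 := by
    intro x hx
    by_contra hne
    have h1 := (P - Q).le_opNorm x
    rw [hx] at h1
    have := norm_pos_iff.2 hne
    nlinarith
  refine compactEquiv_of_trivial_intersection hP hQ hc (fun x h1 h2 => key x ?_)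
    (fun x h1 h2 => key x ?_) <;> simp [h1, h2]

/-- A projection is not conjugate to a proper subprojection. -/
theorem CompactEquiv.eq_of_mul_eq {E E₁ : H →L[ℂ] H} (h : CompactEquiv E E₁)
    (hE : IsStarProjection E) (hE₁ : IsStarProjection E₁) (hle : E * E₁ = E₁) : E₁ = E := by
  obtain ⟨U, hU, h⟩ := h
  have hEx : ∀ x, E (E x) = E x := fun x => congr($hE.isIdempotentElem x)
  have hE₁x : ∀ x, E₁ (E₁ x) = E₁ x := fun x => congr($hE₁.isIdempotentElem x)
  have hlex : ∀ x, E (E₁ x) = E₁ x := fun x => congr($hle x)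
  have hx : ∀ x, (U : H →L[ℂ] H) (E x) = E₁ ((U : H →L[ℂ] H) x) := fun x => congr($h x)
  -- `T` is `U` on `R(E)` and the identity on `N(E)`. It is injective, hence surjective; since `ET =
  -- UE = E₁U`, surjectivity forces `R(E) ⊆ R(E₁)`.
  set T : H →L[ℂ] H := (U : H →L[ℂ] H) * E + (1 - E) with hT
  have hTx : ∀ x, T x = (U : H →L[ℂ] H) (E x) + (x - E x) := fun x => rfl
  have hET : ∀ x, E (T x) = (U : H →L[ℂ] H) (E x) := by
    intro x
    rw [hTx, map_add, map_sub, hEx, sub_self, add_zero, hx, hlex]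
  have hunit : IsUnit T := by
    refine isUnit_of_isCompactOperator_sub_one ?_ fun x h0 => ?_
    · have : T - 1 = ((U : H →L[ℂ] H) - 1) * E := by rw [hT]; noncomm_ring
      rw [this]
      exact isCompactOperator_mul_right hU _
    · have h3 : (U : H →L[ℂ] H) (E x) = 0 := by rw [← hET, h0, map_zero]
      have h4 : E x = 0 := by rw [← norm_eq_zero, ← Unitary.norm_map U, h3, norm_zero]
      rw [hTx, h4] at h0
      simpa using h0
  have hE₁E : E₁ * E = E := by
    ext y
    obtain ⟨x, hxy⟩ := (ContinuousLinearMap.isUnit_iff_bijective.1 hunit).2 (E y)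
    have h5 := hET x
    rw [hxy, hEx, hx] at h5
    change E₁ (E y) = E y
    rw [h5, hE₁x]
  have h6 := congrArg star hE₁E
  rw [star_mul, hE.isSelfAdjoint.star_eq, hE₁.isSelfAdjoint.star_eq, hle] at h6
  exact h6

end

/-! ### Finite-dimensional corrections of projections -/

section

variable {H : Type*} [NormedAddCommGroup H] [InnerProductSpace ℂ H]

theorem finiteDimensional_of_isCompactOperator {K : H →L[ℂ] H} (hK : IsCompactOperator K)
    {V : Submodule ℂ H} (hV : IsClosed (V : Set H)) (h : ∀ x ∈ V, K x = x) :
    FiniteDimensional ℂ V := by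
  refine FiniteDimensional.of_isCompactOperator_id ?_
  have h1 : IsCompactOperator (K ∘ V.subtypeL) := hK.comp_clm V.subtypeL
  have h2 : ∀ x : V, (K ∘ V.subtypeL) x ∈ V := fun x => by
    have : K x = x := h x x.2
    simp [this]
  have h3 : (id : V → V) = Set.codRestrict (K ∘ V.subtypeL) V h2 := by
    funext x
    exact Subtype.ext (h x x.2).symm
  rw [h3]
  exact h1.codRestrict h2 hV

/-- For projections `P`, `Q` this is `R(P) ∩ N(Q)`. -/
def rangeInfKer (P Q : H →L[ℂ] H) : Submodule ℂ H :=
  LinearMap.ker (1 - P).toLinearMap ⊓ LinearMap.ker Q.toLinearMap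

theorem mem_rangeInfKer {P Q : H →L[ℂ] H} {x : H} :
    x ∈ rangeInfKer P Q ↔ P x = x ∧ Q x = 0 := by
  simp [rangeInfKer, sub_eq_zero, eq_comm (a := x)]

theorem rangeInfKer_one_sub (P Q : H →L[ℂ] H) :
    rangeInfKer (1 - P) (1 - Q) = rangeInfKer Q P := by
  ext x
  simp [mem_rangeInfKer, sub_eq_zero, eq_comm (a := x), and_comm]

theorem finiteDimensional_rangeInfKer {P Q : H →L[ℂ] H}
    (hc : IsCompactOperator (P - Q : H →L[ℂ] H)) : FiniteDimensional ℂ (rangeInfKer P Q) := by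
  refine finiteDimensional_of_isCompactOperator hc ?_ fun x hx => ?_
  · exact (1 - P).isClosed_ker.inter Q.isClosed_ker
  · obtain ⟨h1, h2⟩ := mem_rangeInfKer.1 hx
    simp [h1, h2]

theorem isCompactOperator_starProjection (F : Submodule ℂ H) [FiniteDimensional ℂ F] :
    IsCompactOperator F.starProjection := by
  have : IsCompactOperator (F.orthogonalProjectionOnto : H →L[ℂ] F) :=
    isCompactOperator_of_locallyCompactSpace_dom _
  exact this.clm_comp F.subtypeL

theorem mul_starProjection_of_forall_eq {P : H →L[ℂ] H} {F : Submodule ℂ H}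
    [F.HasOrthogonalProjection] (h : ∀ x ∈ F, P x = x) : P * F.starProjection = F.starProjection := by
  ext x
  exact h _ (F.starProjection_apply_mem x)

theorem mul_starProjection_of_forall_eq_zero {P : H →L[ℂ] H} {F : Submodule ℂ H}
    [F.HasOrthogonalProjection] (h : ∀ x ∈ F, P x = 0) : P * F.starProjection = 0 := by
  ext x
  exact h _ (F.starProjection_apply_mem x)

variable [CompleteSpace H]

theorem star_starProjection (F : Submodule ℂ H) [F.HasOrthogonalProjection] :
    star F.starProjection = F.starProjection :=
  (isSelfAdjoint_starProjection F).star_eq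

theorem starProjection_mul_of_forall_eq {P : H →L[ℂ] H} (hP : IsStarProjection P)
    {F : Submodule ℂ H} [F.HasOrthogonalProjection] (h : ∀ x ∈ F, P x = x) :
    F.starProjection * P = F.starProjection := by
  have := congrArg star (mul_starProjection_of_forall_eq h)
  rwa [star_mul, star_starProjection, hP.isSelfAdjoint.star_eq] at this

theorem starProjection_mul_of_forall_eq_zero {P : H →L[ℂ] H} (hP : IsStarProjection P)
    {F : Submodule ℂ H} [F.HasOrthogonalProjection] (h : ∀ x ∈ F, P x = 0) :
    F.starProjection * P = 0 := by
  have := congrArg star (mul_starProjection_of_forall_eq_zero h)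
  rwa [star_mul, star_starProjection, hP.isSelfAdjoint.star_eq, star_zero] at this

/-- If `P - Q` is compact, then `Q` is conjugate to the projection obtained from `P` by
replacing `R(P) ∩ N(Q)` with `N(P) ∩ R(Q)`. -/
theorem compactEquiv_exchange {P Q : H →L[ℂ] H} (hP : IsStarProjection P)
    (hQ : IsStarProjection Q) (hc : IsCompactOperator (P - Q : H →L[ℂ] H))
    (F G : Submodule ℂ H) [FiniteDimensional ℂ F] [FiniteDimensional ℂ G]
    (hF : F = rangeInfKer P Q) (hG : G = rangeInfKer Q P) :
    CompactEquiv Q (P - F.starProjection + G.starProjection) := by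
  have hFm : ∀ x, x ∈ F ↔ P x = x ∧ Q x = 0 := fun x => by rw [hF, mem_rangeInfKer]
  have hGm : ∀ x, x ∈ G ↔ Q x = x ∧ P x = 0 := fun x => by rw [hG, mem_rangeInfKer]
  have hPp := mul_starProjection_of_forall_eq (P := P) (F := F) fun x hx => ((hFm x).1 hx).1
  have hpP := starProjection_mul_of_forall_eq hP (F := F) fun x hx => ((hFm x).1 hx).1
  have hpQ := starProjection_mul_of_forall_eq_zero hQ (F := F) fun x hx => ((hFm x).1 hx).2
  have hPq := mul_starProjection_of_forall_eq_zero (P := P) (F := G) fun x hx => ((hGm x).1 hx).2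
  have hqQ := starProjection_mul_of_forall_eq hQ (F := G) fun x hx => ((hGm x).1 hx).1
  have hqP := starProjection_mul_of_forall_eq_zero hP (F := G) fun x hx => ((hGm x).1 hx).2
  have hpq : F.starProjection * G.starProjection = 0 := by
    rw [← hpP, mul_assoc, hPq, mul_zero]
  have hqp : G.starProjection * F.starProjection = 0 := by
    rw [← hPp, ← mul_assoc, hqP, zero_mul]
  have hfix : ∀ (K : Submodule ℂ H) [FiniteDimensional ℂ K] (x : H), x ∈ K →
      K.starProjection x = x := fun K _ x hx => Submodule.starProjection_eq_self_iff.2 hx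
  have hproj : IsStarProjection (P - F.starProjection + G.starProjection) := by
    refine (isStarProjection_starProjection.sub_of_mul_eq_left hP ?_).add
      isStarProjection_starProjection ?_
    · exact hpP
    · rw [sub_mul, hPq, hpq, sub_zero]
  -- After the exchange both obstructing intersections vanish: a vector in either one would lie in
  -- `G` or in `F`, yet is annihilated by both of their projections.
  refine compactEquiv_of_trivial_intersection hQ hproj ?_ ?_ ?_
  · have : Q - (P - F.starProjection + G.starProjection)
        = -(P - Q) + F.starProjection - G.starProjection := by abel
    rw [this]
    exact (hc.neg.add (isCompactOperator_starProjection F)).sub (isCompactOperator_starProjection G)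
  · intro x hx h0
    have h1 : G.starProjection x = 0 := by
      have h2 := congrArg G.starProjection h0
      have h3 : G.starProjection * (P - F.starProjection + G.starProjection) = G.starProjection := by
        rw [mul_add, mul_sub, hqP, hqp, G.isIdempotentElem_starProjection]; simp
      rw [map_zero] at h2
      rw [← h3]; exact h2
    have h2 : F.starProjection x = 0 := by rw [← hx]; exact congr($hpQ x)
    have h3 : P x = 0 := by simpa [h1, h2] using h0
    rw [← hfix G x ((hGm x).2 ⟨hx, h3⟩), h1]
  · intro x hx h0
    have h1 : G.starProjection x = 0 := by
      rw [← hqQ]; change G.starProjection (Q x) = 0; rw [hx, map_zero]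
    have h2 : F.starProjection x = 0 := by
      have h3 : F.starProjection * (P - F.starProjection + G.starProjection) = 0 := by
        rw [mul_add, mul_sub, hpP, hpq, F.isIdempotentElem_starProjection]; simp
      rw [← h0]; exact congr($h3 x)
    have h3 : P x = x := by simpa [h1, h2] using h0
    rw [← hfix F x ((hFm x).2 ⟨h3, hx⟩), h2]

/-- A unitary operator of a finite-dimensional subspace, extended by the identity. -/
theorem exists_compactUnitary_extend (V : Submodule ℂ H) [FiniteDimensional ℂ V] (L : V →ₗᵢ[ℂ] V) :
    ∃ U ∈ compactUnitary H, (∀ x : V, (U : H →L[ℂ] H) x = L x) ∧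
      ∀ x ∈ Vᗮ, (U : H →L[ℂ] H) x = x := by
  let T : H →L[ℂ] H := V.subtypeL ∘L L.toContinuousLinearMap ∘L V.orthogonalProjectionOnto +
    (1 - V.starProjection)
  have hT : ∀ x, T x = (L (V.orthogonalProjectionOnto x) : H) + (x - V.starProjection x) :=
    fun x => rfl
  have hV : ∀ x : V, T x = L x := by
    intro x
    rw [hT, Submodule.starProjection_eq_self_iff.2 x.2]
    simp
  have hV' : ∀ x ∈ Vᗮ, T x = x := by
    intro x hx
    have h1 : V.starProjection x = 0 := (V.starProjection_apply_eq_zero_iff).2 hx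
    have h2 : V.orthogonalProjectionOnto x = 0 := by
      ext; exact h1
    rw [hT, h1, h2]; simp
  have hnorm : ∀ x, ‖T x‖ = ‖x‖ := by
    intro x
    have h1 : x - V.starProjection x ∈ Vᗮ := V.sub_starProjection_mem_orthogonal x
    have h2 := norm_add_sq_eq_norm_sq_add_norm_sq_of_inner_eq_zero
      (L (V.orthogonalProjectionOnto x) : H) (x - V.starProjection x)
      (Submodule.inner_right_of_mem_orthogonal (SetLike.coe_mem _) h1)
    have h3 := norm_add_sq_eq_norm_sq_add_norm_sq_of_inner_eq_zero
      (V.orthogonalProjectionOnto x : H) (x - V.starProjection x)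
      (Submodule.inner_right_of_mem_orthogonal (SetLike.coe_mem _) h1)
    have h4 : ‖(L (V.orthogonalProjectionOnto x) : H)‖ = ‖(V.orthogonalProjectionOnto x : H)‖ :=
      L.norm_map _
    have h5 : (V.orthogonalProjectionOnto x : H) + (x - V.starProjection x) = x := by
      rw [← Submodule.starProjection_apply]; abel
    rw [← hT, h4, ← h3, h5] at h2
    nlinarith [norm_nonneg (T x), norm_nonneg x]
  have hsurj : Function.Surjective T := by
    intro y
    have hLs : Function.Surjective L := LinearMap.injective_iff_surjective.1 L.injective
    obtain ⟨z, hz⟩ := hLs (V.orthogonalProjectionOnto y)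
    refine ⟨z + (y - V.starProjection y), ?_⟩
    rw [map_add, hV, hV' _ (V.sub_starProjection_mem_orthogonal y), hz,
      ← Submodule.starProjection_apply]
    abel
  let e : H ≃ₗᵢ[ℂ] H := LinearIsometryEquiv.ofSurjective ⟨T.toLinearMap, hnorm⟩ hsurj
  refine ⟨Unitary.linearIsometryEquiv.symm e, ?_, hV, hV'⟩
  rw [mem_compactUnitary]
  have : ((Unitary.linearIsometryEquiv.symm e : unitary (H →L[ℂ] H)) : H →L[ℂ] H) - 1
      = T * V.starProjection - V.starProjection := by
    ext x
    change T x - x = T (V.starProjection x) - V.starProjection x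
    have h1 := hV' _ (V.sub_starProjection_mem_orthogonal x)
    rw [map_sub] at h1
    rw [sub_eq_sub_iff_sub_eq_sub, h1]
  rw [this]
  exact (isCompactOperator_mul_left (isCompactOperator_starProjection V) _).sub
    (isCompactOperator_starProjection V)

/-- Two finite-rank projections of equal rank, both orthogonal to a projection `P`, are
interchanged by a unitary operator that commutes with `P`. -/
theorem compactEquiv_add_starProjection {P : H →L[ℂ] H} (hP : IsStarProjection P)
    (F G : Submodule ℂ H) [FiniteDimensional ℂ F] [FiniteDimensional ℂ G]
    (hF : ∀ x ∈ F, P x = 0) (hG : ∀ x ∈ G, P x = 0)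
    (hrank : Module.finrank ℂ F = Module.finrank ℂ G) :
    CompactEquiv (P + F.starProjection) (P + G.starProjection) := by
  let V : Submodule ℂ H := F ⊔ G
  have hFV : F ≤ V := le_sup_left
  have hGV : G ≤ V := le_sup_right
  have hPV : ∀ x ∈ V, P x = 0 := by
    have h1 : V ≤ LinearMap.ker P.toLinearMap := sup_le hF hG
    exact fun x hx => h1 hx
  -- An isometry from `F` onto `G` extends to one of the finite-dimensional `V = F ⊔ G`, then by the
  -- identity on `Vᗮ`, which contains `R(P)`.
  let e : F ≃ₗᵢ[ℂ] G :=
    (stdOrthonormalBasis ℂ F).equiv (stdOrthonormalBasis ℂ G) (finCongr hrank)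
  let S : Submodule ℂ V := F.comap V.subtype
  let L : S →ₗᵢ[ℂ] V :=
    { toFun := fun x => ⟨e ⟨x.1, x.2⟩, hGV (SetLike.coe_mem _)⟩
      map_add' := fun x y => by
        exact congrArg (fun z : G => (⟨z, hGV z.2⟩ : V)) (e.map_add ⟨x.1, x.2⟩ ⟨y.1, y.2⟩)
      map_smul' := fun c x => by
        exact congrArg (fun z : G => (⟨z, hGV z.2⟩ : V)) (e.map_smul c ⟨x.1, x.2⟩)
      norm_map' := fun x => e.norm_map ⟨x.1, x.2⟩ }
  obtain ⟨U, hU, hUV, hUV'⟩ := exists_compactUnitary_extend V L.extend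
  have hUF : ∀ x : F, (U : H →L[ℂ] H) x = e x := by
    intro x
    have h1 := hUV ⟨x, hFV x.2⟩
    have h2 := L.extend_apply ⟨⟨x, hFV x.2⟩, x.2⟩
    rw [h2] at h1
    exact h1
  have hmap : F.map ((Unitary.linearIsometryEquiv U).toLinearEquiv : H →ₗ[ℂ] H) = G := by
    apply le_antisymm
    · rintro _ ⟨x, hx, rfl⟩
      change (U : H →L[ℂ] H) x ∈ G
      rw [hUF ⟨x, hx⟩]
      exact SetLike.coe_mem _
    · intro y hy
      refine ⟨e.symm ⟨y, hy⟩, SetLike.coe_mem _, ?_⟩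
      change (U : H →L[ℂ] H) (e.symm ⟨y, hy⟩) = y
      rw [hUF, e.apply_symm_apply]
  have hPU : P * U = P := by
    have h0 : ∀ z ∈ V, P ((U : H →L[ℂ] H) z) = 0 := fun z hz => by
      rw [hUV ⟨z, hz⟩]; exact hPV _ (SetLike.coe_mem _)
    ext x
    have h1 : (U : H →L[ℂ] H) (x - V.starProjection x) = x - V.starProjection x :=
      hUV' _ (V.sub_starProjection_mem_orthogonal x)
    have h2 := congrArg P h1
    rw [map_sub, map_sub, map_sub, h0 _ (V.starProjection_apply_mem x),
      hPV _ (V.starProjection_apply_mem x), sub_zero, sub_zero] at h2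
    exact h2
  have hUP : U * P = P := by
    ext x
    refine hUV' _ ?_
    rw [Submodule.mem_orthogonal]
    intro u hu
    have h1 := (ContinuousLinearMap.isSelfAdjoint_iff_isSymmetric.1 hP.isSelfAdjoint) u x
    change inner ℂ (P u) x = inner ℂ u (P x) at h1
    exact h1.symm.trans (by rw [hPV u hu, inner_zero_left])
  refine ⟨U, hU, ?_⟩
  have hUp : (U : H →L[ℂ] H) * F.starProjection = G.starProjection * U := by
    ext x
    have h1 := Submodule.starProjection_map_apply (Unitary.linearIsometryEquiv U) F
      ((U : H →L[ℂ] H) x)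
    have h2 : (Unitary.linearIsometryEquiv U).symm ((U : H →L[ℂ] H) x) = x :=
      (Unitary.linearIsometryEquiv U).symm_apply_apply x
    rw [h2] at h1
    simp only [hmap] at h1
    exact h1.symm
  rw [mul_add, add_mul, hUP, hPU, hUp]

end

/-! ### Diagonal projections and compactness modulo the diagonal -/

section

section Basis

variable {H : Type*} [NormedAddCommGroup H] [InnerProductSpace ℂ H] (b : HilbertBasis ℕ ℂ H)

theorem separableSpace_of_hilbertBasis {H : Type*} [NormedAddCommGroup H]
    [InnerProductSpace ℂ H] (b : HilbertBasis ℕ ℂ H) : TopologicalSpace.SeparableSpace H := by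
  have h : TopologicalSpace.IsSeparable (Submodule.span ℂ (Set.range b) : Set H) :=
    (Set.countable_range b).isSeparable.span
  have h1 := h.closure
  rw [← Submodule.topologicalClosure_coe, b.dense_span] at h1
  exact TopologicalSpace.isSeparable_univ_iff.1 h1

theorem ext_hilbertBasis {F : Type*} [NormedAddCommGroup F] [NormedSpace ℂ F] {S T : H →L[ℂ] F}
    (h : ∀ n, S (b n) = T (b n)) : S = T := by
  refine ContinuousLinearMap.ext_on (s := Set.range b) ?_ ?_
  · exact (Submodule.dense_iff_topologicalClosure_eq_top).2 b.dense_span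
  · rintro _ ⟨n, rfl⟩
    exact h n

theorem inner_diagonal {T : H →L[ℂ] H} {d : ℕ → ℂ} (h : ∀ n, T (b n) = d n • b n) (n : ℕ) (x : H) :
    inner ℂ (b n) (T x) = d n * inner ℂ (b n) x := by
  have : (innerSL ℂ (b n)).comp T = d n • innerSL ℂ (b n) := by
    refine ext_hilbertBasis b fun m => ?_
    by_cases hmn : n = m
    · subst hmn
      simp [h]
    · simp [h, orthonormal_iff_ite.1 b.orthonormal, hmn]
  exact congr($this x)

theorem hasSum_norm_inner_sq (x : H) : HasSum (fun n => ‖inner ℂ (b n) x‖ ^ 2) (‖x‖ ^ 2) := by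
  have h := lp.hasSum_norm (p := 2) (by norm_num) (b.repr x)
  rw [b.repr.norm_map] at h
  simpa [b.repr_apply_apply] using h

theorem norm_diagonal_le {T : H →L[ℂ] H} {d : ℕ → ℂ} (h : ∀ n, T (b n) = d n • b n) {C : ℝ}
    (hC : 0 ≤ C) (hd : ∀ n, ‖d n‖ ≤ C) : ‖T‖ ≤ C := by
  refine T.opNorm_le_bound hC fun x => ?_
  refine le_of_sq_le_sq ?_ (by positivity)
  rw [mul_pow]
  refine hasSum_le (fun n => ?_) (hasSum_norm_inner_sq b (T x))
    ((hasSum_norm_inner_sq b x).mul_left (C ^ 2))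
  rw [inner_diagonal b h, norm_mul, mul_pow]
  gcongr
  exact hd n

theorem tendsto_inner_hilbertBasis (x : H) : Tendsto (fun n => inner ℂ x (b n)) atTop (𝓝 0) := by
  have h := (hasSum_norm_inner_sq b x).summable.tendsto_atTop_zero
  have h2 : Tendsto (fun n => ‖inner ℂ (b n) x‖) atTop (𝓝 0) := by
    have := (Real.continuous_sqrt.tendsto 0).comp h
    simpa [Function.comp_def] using this
  rw [tendsto_zero_iff_norm_tendsto_zero]
  simpa [norm_inner_symm] using h2

theorem finiteDimensional_span_image {A : Set ℕ} (hA : A.Finite) :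
    FiniteDimensional ℂ (Submodule.span ℂ (b '' A)) :=
  FiniteDimensional.span_of_finite ℂ (hA.image b)

theorem finrank_span_image {A : Set ℕ} (hA : A.Finite) :
    Module.finrank ℂ (Submodule.span ℂ (b '' A)) = A.ncard := by
  have := hA.fintype
  have h1 : LinearIndependent ℂ (fun n : A => b n) :=
    b.orthonormal.linearIndependent.comp _ Subtype.val_injective
  rw [show b '' A = Set.range (fun n : A => b n) by ext; simp, finrank_span_eq_card h1,
    Set.ncard_eq_toFinset_card', Set.toFinset_card]

/-- `K` may be the closed span or, for finite `A`, the span itself; this identifies the two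
projections. -/
theorem starProjection_span_apply (A : Set ℕ) (K : Submodule ℂ H) [K.HasOrthogonalProjection]
    (h1 : ∀ n ∈ A, b n ∈ K) (h2 : K ≤ (Submodule.span ℂ (b '' A)).topologicalClosure) (n : ℕ)
    [Decidable (n ∈ A)] : K.starProjection (b n) = if n ∈ A then b n else 0 := by
  split_ifs with hn
  · exact Submodule.starProjection_eq_self_iff.2 (h1 n hn)
  · rw [Submodule.starProjection_apply_eq_zero_iff]
    refine Submodule.orthogonal_le h2 ?_
    rw [Submodule.orthogonal_closure, Submodule.mem_orthogonal]
    intro u hu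
    induction hu using Submodule.span_induction with
    | mem x hx =>
      obtain ⟨m, hm, rfl⟩ := hx
      refine b.orthonormal.2 ?_
      rintro rfl
      exact hn hm
    | zero => simp
    | add x y _ _ hx hy => rw [inner_add_left, hx, hy, add_zero]
    | smul c x _ hx => rw [inner_smul_left, hx, mul_zero]

variable [CompleteSpace H]

/-- The images lie in a compact set, and a cluster point `y` satisfies `⟨y, y⟩ = 0`, because `⟨y, K
bₙ⟩ = ⟨K* y, bₙ⟩` tends to zero. -/
theorem tendsto_compact_hilbertBasis {K : H →L[ℂ] H} (hK : IsCompactOperator K) :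
    Tendsto (fun n => K (b n)) atTop (𝓝 0) := by
  obtain ⟨s, hs, hKs⟩ := hK.image_closedBall_subset_compact 1
  refine hs.tendsto_nhds_of_unique_mapClusterPt
    (Eventually.of_forall fun n => hKs ⟨b n, by simp [b.orthonormal.1 n], rfl⟩) ?_
  intro y _ hy
  have h1 : MapClusterPt (inner ℂ y y) atTop (fun n => inner ℂ y (K (b n))) :=
    hy.continuousAt_comp (f := fun z => inner ℂ y z) (by fun_prop)
  have h2 : Tendsto (fun n => inner ℂ y (K (b n))) atTop (𝓝 0) := by
    have := tendsto_inner_hilbertBasis b (ContinuousLinearMap.adjoint K y)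
    simpa [ContinuousLinearMap.adjoint_inner_left] using this
  have h3 : inner ℂ y y = 0 := by
    have : (𝓝 (inner ℂ y y) ⊓ 𝓝 (0 : ℂ)).NeBot :=
      NeBot.mono h1 (inf_le_inf_left _ h2)
    exact eq_of_nhds_neBot this
  exact inner_self_eq_zero.1 h3

/-- The diagonal projection onto the closed span of the basis vectors indexed by `A`. -/
def diagProj (A : Set ℕ) : H →L[ℂ] H :=
  (Submodule.span ℂ (b '' A)).topologicalClosure.starProjection

theorem isStarProjection_diagProj (A : Set ℕ) : IsStarProjection (diagProj b A) :=
  isStarProjection_starProjection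

open Classical in
theorem diagProj_apply (A : Set ℕ) (n : ℕ) :
    diagProj b A (b n) = if n ∈ A then b n else 0 :=
  starProjection_span_apply b A _
    (fun _ hn => Submodule.le_topologicalClosure _
      (Submodule.subset_span (Set.mem_image_of_mem b hn))) le_rfl n

theorem diagProj_apply_of_mem {A : Set ℕ} {n : ℕ} (h : n ∈ A) : diagProj b A (b n) = b n := by
  classical rw [diagProj_apply, if_pos h]

theorem diagProj_apply_of_notMem {A : Set ℕ} {n : ℕ} (h : n ∉ A) : diagProj b A (b n) = 0 := by
  classical rw [diagProj_apply, if_neg h]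

theorem diagProj_apply_eq_self_iff {A : Set ℕ} {n : ℕ} : diagProj b A (b n) = b n ↔ n ∈ A := by
  refine ⟨fun h => ?_, diagProj_apply_of_mem b⟩
  by_contra hn
  rw [diagProj_apply_of_notMem b hn] at h
  exact b.orthonormal.ne_zero n h.symm

theorem diagProj_apply_eq_zero_iff {A : Set ℕ} {n : ℕ} : diagProj b A (b n) = 0 ↔ n ∉ A := by
  refine ⟨fun h hn => ?_, diagProj_apply_of_notMem b⟩
  rw [diagProj_apply_of_mem b hn] at h
  exact b.orthonormal.ne_zero n h

theorem diagProj_injective : Function.Injective (diagProj b) := by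
  intro A B h
  ext n
  rw [← diagProj_apply_eq_self_iff b, h, diagProj_apply_eq_self_iff]

theorem diagProj_eq_starProjection (A : Set ℕ) [FiniteDimensional ℂ (Submodule.span ℂ (b '' A))] :
    diagProj b A = (Submodule.span ℂ (b '' A)).starProjection := by
  classical
  refine ext_hilbertBasis b fun n => ?_
  rw [diagProj_apply, starProjection_span_apply b A _
    (fun _ hn => Submodule.subset_span (Set.mem_image_of_mem b hn)) (Submodule.le_topologicalClosure _)]

theorem one_sub_diagProj (A : Set ℕ) : 1 - diagProj b A = diagProj b Aᶜ := by
  classical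
  refine ext_hilbertBasis b fun n => ?_
  by_cases h : n ∈ A <;> simp [diagProj_apply, h]

theorem diagProj_union {A B : Set ℕ} (h : Disjoint A B) :
    diagProj b (A ∪ B) = diagProj b A + diagProj b B := by
  classical
  refine ext_hilbertBasis b fun n => ?_
  by_cases hA : n ∈ A
  · simp [diagProj_apply, hA, Set.disjoint_left.1 h hA]
  · simp [diagProj_apply, hA]

theorem diagProj_mul (A B : Set ℕ) : diagProj b A * diagProj b B = diagProj b (A ∩ B) := by
  classical
  refine ext_hilbertBasis b fun n => ?_
  by_cases hA : n ∈ A <;> by_cases hB : n ∈ B <;> simp [diagProj_apply, hA, hB]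

theorem isDiagonal_diagProj (A : Set ℕ) : IsDiagonal b (diagProj b A) := by
  classical
  refine ⟨fun n => if n ∈ A then 1 else 0, fun n => ?_⟩
  by_cases h : n ∈ A <;> simp [diagProj_apply, h]

theorem exists_eq_diagProj {E : H →L[ℂ] H} (hE : IsStarProjection E) (hd : IsDiagonal b E) :
    ∃ A, E = diagProj b A := by
  classical
  obtain ⟨d, hd⟩ := hd
  refine ⟨{n | E (b n) = b n}, ext_hilbertBasis b fun n => ?_⟩
  rw [diagProj_apply]
  split_ifs with hn
  · exact hn
  · have h1 : E (E (b n)) = E (b n) := congr($hE.isIdempotentElem (b n))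
    rw [hd, map_smul, hd, smul_smul] at h1
    have h2 : d n * d n = d n := smul_left_injective ℂ (b.orthonormal.ne_zero n) h1
    rcases IsIdempotentElem.iff_eq_zero_or_one.1 h2 with h | h
    · rw [hd, h, zero_smul]
    · exact absurd (by rw [Set.mem_ofPred_eq, hd, h, one_smul]) hn

theorem isCompactOperator_diagProj_iff {A : Set ℕ} :
    IsCompactOperator (diagProj b A) ↔ A.Finite := by
  constructor
  · intro h
    by_contra hA
    have h1 := (tendsto_compact_hilbertBasis b h).norm
    rw [norm_zero] at h1
    have h2 := h1.eventually (gt_mem_nhds one_pos)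
    obtain ⟨N, hN⟩ := eventually_atTop.1 h2
    obtain ⟨n, hn, hNn⟩ := Set.Infinite.exists_gt hA N
    have h3 := hN n hNn.le
    rw [diagProj_apply_of_mem b hn, b.orthonormal.1 n] at h3
    exact lt_irrefl _ h3
  · intro h
    have := finiteDimensional_span_image b h
    rw [diagProj_eq_starProjection]
    exact isCompactOperator_starProjection _

/-- The truncations to the first `N` basis vectors have finite rank and converge in norm. -/
theorem isCompactOperator_diagonal {T : H →L[ℂ] H} {d : ℕ → ℂ} (h : ∀ n, T (b n) = d n • b n)
    (hd : Tendsto d atTop (𝓝 0)) : IsCompactOperator T := by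
  classical
  have key : Tendsto (fun N => T * diagProj b (Set.Iio N)) atTop (𝓝 T) := by
    rw [Metric.tendsto_atTop]
    intro ε hε
    obtain ⟨N, hN⟩ := Metric.tendsto_atTop.1 hd (ε / 2) (by positivity)
    refine ⟨N, fun M hM => ?_⟩
    rw [dist_eq_norm]
    have h1 : ∀ n, (T * diagProj b (Set.Iio M) - T) (b n)
        = (if n ∈ Set.Iio M then 0 else -d n) • b n := by
      intro n
      change T (diagProj b (Set.Iio M) (b n)) - T (b n) = _
      rw [diagProj_apply]
      split_ifs <;> simp [h]
    refine (norm_diagonal_le b h1 (C := ε / 2) (by positivity) fun n => ?_).trans_lt (by linarith)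
    split_ifs with hn
    · simp; positivity
    · have := hN n (hM.trans (by simpa using hn))
      rw [dist_zero_right] at this
      rw [norm_neg]
      exact this.le
  refine isCompactOperator_of_tendsto key (Eventually.of_forall fun N => ?_)
  exact isCompactOperator_mul_left ((isCompactOperator_diagProj_iff b).2 (Set.finite_Iio N)) T

theorem isCompactOperator_diagProj_sub_iff {A B : Set ℕ} :
    IsCompactOperator (diagProj b A - diagProj b B : H →L[ℂ] H) ↔
      (A \ B).Finite ∧ (B \ A).Finite := by
  have h : ∀ A B : Set ℕ, diagProj b A = diagProj b (A ∩ B) + diagProj b (A \ B) := fun A B => by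
    rw [← diagProj_union b Set.disjoint_sdiff_inter.symm, Set.inter_union_sdiff]
  have h1 : ∀ A B : Set ℕ, IsCompactOperator (diagProj b A - diagProj b B : H →L[ℂ] H) →
      (A \ B).Finite := fun A B hc => by
    rw [← isCompactOperator_diagProj_iff b]
    have := isCompactOperator_mul_left hc (diagProj b (A \ B))
    rwa [mul_sub, diagProj_mul, diagProj_mul, Set.sdiff_inter_self, Set.inter_eq_left.2 Set.sdiff_subset,
      show diagProj b (∅ : Set ℕ) = 0 from ext_hilbertBasis b fun n => by
        simp [diagProj_apply], sub_zero] at this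
  refine ⟨fun hc => ⟨h1 A B hc, h1 B A ?_⟩, fun ⟨hA, hB⟩ => ?_⟩
  · rw [← neg_sub]; exact hc.neg
  · rw [h A B, h B A, Set.inter_comm B A, add_sub_add_left_eq_sub]
    exact ((isCompactOperator_diagProj_iff b).2 hA).sub ((isCompactOperator_diagProj_iff b).2 hB)

/-- Idempotence modulo compacts gives `dₙ(dₙ - 1) → 0`. Rounding each `dₙ` to the nearer of `0` and
`1` leaves an error of at most `√(|dₙ| |dₙ - 1|)`. -/
theorem exists_isCompactOperator_sub_diagProj {P : H →L[ℂ] H} (hP : P ∈ projections b) :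
    ∃ A, IsCompactOperator (P - diagProj b A : H →L[ℂ] H) := by
  classical
  obtain ⟨hproj, D, K, ⟨d, hd⟩, hK, rfl⟩ := hP
  have hc : IsCompactOperator (D * D - D : H →L[ℂ] H) := by
    have h1 : (D + K) * (D + K) = D + K := hproj.isIdempotentElem
    have h2 : D * D - D = K - (D + K) * K - K * D := by
      have : D * D - D = (D + K) * (D + K) - (D + K) * K - K * D - D := by noncomm_ring
      rw [this, h1]; abel
    rw [h2]
    exact (hK.sub (isCompactOperator_mul_left hK _)).sub (isCompactOperator_mul_right hK _)
  have h0 : Tendsto (fun n => ‖d n‖ * ‖d n - 1‖) atTop (𝓝 0) := by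
    have h1 := (tendsto_compact_hilbertBasis b hc).norm
    rw [norm_zero] at h1
    refine h1.congr fun n => ?_
    have : (D * D - D) (b n) = (d n * (d n - 1)) • b n := by
      change D (D (b n)) - D (b n) = _
      rw [hd, map_smul, hd, smul_smul, ← sub_smul]; ring_nf
    rw [this, norm_smul, norm_mul, b.orthonormal.1 n, mul_one]
  refine ⟨{n | ‖d n - 1‖ < ‖d n‖}, ?_⟩
  rw [add_sub_right_comm]
  refine IsCompactOperator.add ?_ hK
  refine isCompactOperator_diagonal b
    (d := fun n => d n - if ‖d n - 1‖ < ‖d n‖ then 1 else 0) (fun n => ?_) ?_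
  · rw [sub_apply, diagProj_apply, hd, sub_smul]
    simp only [Set.mem_ofPred_eq]
    split_ifs <;> simp
  · rw [tendsto_zero_iff_norm_tendsto_zero]
    have h1 := (Real.continuous_sqrt.tendsto 0).comp h0
    rw [Real.sqrt_zero] at h1
    refine squeeze_zero (fun n => norm_nonneg _) (fun n => ?_) h1
    refine Real.le_sqrt_of_sq_le ?_
    split_ifs with hn
    · nlinarith [norm_nonneg (d n - 1)]
    · rw [sub_zero]; nlinarith [norm_nonneg (d n)]

/-- For large `n`, compactness makes `(E_A - E_B) bₙ` so close to `(P - Q) bₙ` that its norm is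
below one. That norm is `0` or `1`, so `A` and `B` agree eventually. -/
theorem isCompactOperator_sub_of_norm_lt_one {P Q : H →L[ℂ] H} (hP : P ∈ projections b)
    (hQ : Q ∈ projections b) (h : ‖P - Q‖ < 1) : IsCompactOperator (P - Q : H →L[ℂ] H) := by
  classical
  obtain ⟨A, hA⟩ := exists_isCompactOperator_sub_diagProj b hP
  obtain ⟨B, hB⟩ := exists_isCompactOperator_sub_diagProj b hQ
  have hAB : IsCompactOperator (diagProj b A - diagProj b B : H →L[ℂ] H) := by
    have h0 : IsCompactOperator ((Q - diagProj b B) - (P - diagProj b A) : H →L[ℂ] H) := hB.sub hA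
    have h1 := (tendsto_compact_hilbertBasis b h0).norm
    rw [norm_zero] at h1
    obtain ⟨N, hN⟩ := eventually_atTop.1
      (h1.eventually (gt_mem_nhds (show 0 < 1 - ‖P - Q‖ by linarith)))
    have h2 : ∀ n, N ≤ n → (n ∈ A ↔ n ∈ B) := by
      intro n hn
      have h3 := hN n hn
      have h4 : ‖diagProj b A (b n) - diagProj b B (b n)‖ < 1 := by
        have h5 : diagProj b A (b n) - diagProj b B (b n)
            = (P - Q) (b n) + ((Q - diagProj b B) - (P - diagProj b A)) (b n) := by
          simp only [sub_apply]
          abel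
        rw [h5]
        have h6 := (P - Q).le_opNorm (b n)
        rw [b.orthonormal.1 n, mul_one] at h6
        have h7 : ‖((Q - diagProj b B) - (P - diagProj b A)) (b n)‖ < 1 - ‖P - Q‖ := h3
        exact (norm_add_le _ _).trans_lt (by linarith)
      by_cases hA : n ∈ A <;> by_cases hB : n ∈ B <;>
        simp [diagProj_apply, hA, hB, b.orthonormal.1 n] at h4 ⊢
    rw [isCompactOperator_diagProj_sub_iff]
    constructor
    · refine (Set.finite_Iio N).subset fun n hn => ?_
      by_contra hN
      exact hn.2 ((h2 n (by simpa using hN)).1 hn.1)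
    · refine (Set.finite_Iio N).subset fun n hn => ?_
      by_contra hN
      exact hn.2 ((h2 n (by simpa using hN)).2 hn.1)
  have : P - Q = (P - diagProj b A) + (diagProj b A - diagProj b B) - (Q - diagProj b B) := by abel
  rw [this]
  exact (hA.add hAB).sub hB

end Basis

end

/-! ### Diagonal representatives and their classification -/

section

section Submodules

variable {H : Type*} [NormedAddCommGroup H] [InnerProductSpace ℂ H]

theorem starProjection_sup_of_isOrtho {F G : Submodule ℂ H} [F.HasOrthogonalProjection]
    [G.HasOrthogonalProjection] [(F ⊔ G).HasOrthogonalProjection] (h : F ⟂ G) :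
    (F ⊔ G).starProjection = F.starProjection + G.starProjection := by
  ext v
  refine Submodule.eq_starProjection_of_mem_orthogonal
    (u := v) (v := (F.starProjection + G.starProjection) v)
    (Submodule.add_mem_sup (F.starProjection_apply_mem v) (G.starProjection_apply_mem v)) ?_
  rw [← Submodule.inf_orthogonal]
  constructor
  · have h1 : v - (F.starProjection + G.starProjection) v
        = (v - F.starProjection v) - G.starProjection v := by simp [sub_sub]
    rw [h1]
    exact Fᗮ.sub_mem (F.sub_starProjection_mem_orthogonal v)
      (h.symm (G.starProjection_apply_mem v))
  · have h1 : v - (F.starProjection + G.starProjection) v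
        = (v - G.starProjection v) - F.starProjection v := by
      rw [add_apply]; abel
    rw [h1]
    exact Gᗮ.sub_mem (G.sub_starProjection_mem_orthogonal v)
      (h (F.starProjection_apply_mem v))

theorem finrank_sup_of_isOrtho {F G : Submodule ℂ H} [FiniteDimensional ℂ F]
    [FiniteDimensional ℂ G] (h : F ⟂ G) :
    Module.finrank ℂ (F ⊔ G : Submodule ℂ H) = Module.finrank ℂ F + Module.finrank ℂ G := by
  have h1 := Submodule.finrank_sup_add_finrank_inf_eq F G
  rwa [h.disjoint.eq_bot, finrank_bot, add_zero] at h1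

end Submodules

variable {H : Type*} [NormedAddCommGroup H] [InnerProductSpace ℂ H] (b : HilbertBasis ℕ ℂ H)
  [CompleteSpace H]

theorem diagProj_apply_of_mem_span {A : Set ℕ} {x : H} (hx : x ∈ Submodule.span ℂ (b '' A))
    (B : Set ℕ) (h : Disjoint B A) : diagProj b B x = 0 := by
  have h1 : Submodule.span ℂ (b '' A) ≤ LinearMap.ker (diagProj b B).toLinearMap := by
    rw [Submodule.span_le]
    rintro _ ⟨n, hn, rfl⟩
    exact diagProj_apply_of_notMem b fun hB => Set.disjoint_left.1 h hB hn
  exact h1 hx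

/-- With `E = diagProj b B`, exchange makes `E` conjugate to `P - F + G`. Enlarging `B` by `dim F -
dim G` indices from its infinite complement compensates for the smaller rank of `G`. -/
theorem exists_compactEquiv_diagProj_of_finrank_le {P : H →L[ℂ] H} (hP : IsStarProjection P)
    {B : Set ℕ} (hc : IsCompactOperator (P - diagProj b B : H →L[ℂ] H)) (hB : Bᶜ.Infinite)
    (hle : Module.finrank ℂ (rangeInfKer (diagProj b B) P)
      ≤ Module.finrank ℂ (rangeInfKer P (diagProj b B))) :
    ∃ A, CompactEquiv P (diagProj b A) := by
  have hE := isStarProjection_diagProj b B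
  obtain ⟨F, hF⟩ : ∃ F, F = rangeInfKer P (diagProj b B) := ⟨_, rfl⟩
  obtain ⟨G, hG⟩ : ∃ G, G = rangeInfKer (diagProj b B) P := ⟨_, rfl⟩
  have hFf : FiniteDimensional ℂ F := hF ▸ finiteDimensional_rangeInfKer hc
  have hGf : FiniteDimensional ℂ G := hG ▸ finiteDimensional_rangeInfKer (by
    have := hc.neg; rwa [← FunLike.coe_neg, neg_sub] at this)
  rw [← hF, ← hG] at hle
  have hFm : ∀ x, x ∈ F ↔ P x = x ∧ diagProj b B x = 0 := fun x => by rw [hF, mem_rangeInfKer]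
  have hGm : ∀ x, x ∈ G ↔ diagProj b B x = x ∧ P x = 0 := fun x => by rw [hG, mem_rangeInfKer]
  obtain ⟨U, hU, hUE⟩ := compactEquiv_exchange hP hE hc F G hF hG
  have hpP := starProjection_mul_of_forall_eq hP (F := F) fun x hx => ((hFm x).1 hx).1
  have hP0 : IsStarProjection (P - F.starProjection) :=
    isStarProjection_starProjection.sub_of_mul_eq_left hP hpP
  have hpG : ∀ x ∈ G, F.starProjection x = 0 := by
    intro x hx
    rw [← hpP]
    change F.starProjection (P x) = 0
    rw [((hGm x).1 hx).2, map_zero]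
  have hP0F : ∀ x ∈ F, (P - F.starProjection) x = 0 := fun x hx => by
    rw [sub_apply, ((hFm x).1 hx).1, Submodule.starProjection_eq_self_iff.2 hx, sub_self]
  have hP0G : ∀ x ∈ G, (P - F.starProjection) x = 0 := fun x hx => by
    rw [sub_apply, ((hGm x).1 hx).2, hpG x hx, sub_self]
  set P₀ := P - F.starProjection with hP₀
  obtain ⟨C, hCB, hCf, hCcard⟩ := hB.exists_subset_ncard_eq
    (Module.finrank ℂ F - Module.finrank ℂ G)
  have hdisj : Disjoint B C := Set.disjoint_left.2 fun n hn hn' => hCB hn' hn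
  have := finiteDimensional_span_image b hCf
  let e := Unitary.linearIsometryEquiv U
  -- The unitary carries the added basis vectors to `W`, orthogonal to `P₀` and to `G`, so that `G ⊔
  -- W` has the dimension of `F`.
  let W : Submodule ℂ H := (Submodule.span ℂ (b '' C)).map (e.toLinearEquiv : H →ₗ[ℂ] H)
  have hWr : Module.finrank ℂ W = C.ncard := by
    rw [← finrank_span_image b hCf]
    exact LinearEquiv.finrank_map_eq e.toLinearEquiv _
  have hW : ∀ w ∈ W, (P₀ + G.starProjection) w = 0 := by
    rintro _ ⟨x, hx, rfl⟩
    have h1 : (U : H →L[ℂ] H) (diagProj b B x) = (P₀ + G.starProjection) ((U : H →L[ℂ] H) x) :=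
      congr($hUE x)
    rw [diagProj_apply_of_mem_span b hx B hdisj, map_zero] at h1
    exact h1.symm
  have hPq : P₀ * G.starProjection = 0 := mul_starProjection_of_forall_eq_zero hP0G
  have hP0W : ∀ w ∈ W, P₀ w = 0 := by
    intro w hw
    have h1 := congrArg P₀ (hW w hw)
    have h2 : P₀ * (P₀ + G.starProjection) = P₀ := by
      rw [mul_add, hPq, hP0.isIdempotentElem, add_zero]
    rw [map_zero] at h1
    rw [← h2]; exact h1
  have hGW : G ⟂ W := by
    rw [Submodule.isOrtho_comm, Submodule.IsOrtho]
    intro w hw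
    rw [← Submodule.starProjection_apply_eq_zero_iff]
    have := hW w hw
    rwa [add_apply, hP0W w hw, zero_add] at this
  have hUW : (U : H →L[ℂ] H) * diagProj b C = W.starProjection * U := by
    rw [diagProj_eq_starProjection]
    ext x
    have h1 := Submodule.starProjection_map_apply e (Submodule.span ℂ (b '' C))
      ((U : H →L[ℂ] H) x)
    have h2 : e.symm ((U : H →L[ℂ] H) x) = x := e.symm_apply_apply x
    rw [h2] at h1
    exact h1.symm
  have hrank : Module.finrank ℂ F = Module.finrank ℂ (G ⊔ W : Submodule ℂ H) := by
    rw [finrank_sup_of_isOrtho hGW, hWr, hCcard]; omega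
  have hfin := compactEquiv_add_starProjection hP0 F (G ⊔ W) hP0F
    (fun x hx => (sup_le (c := LinearMap.ker P₀.toLinearMap) hP0G hP0W) hx) hrank
  rw [hP₀, sub_add_cancel, ← hP₀, starProjection_sup_of_isOrtho hGW] at hfin
  refine ⟨B ∪ C, hfin.trans (CompactEquiv.symm ⟨U, hU, ?_⟩)⟩
  rw [diagProj_union b hdisj, mul_add, hUE, hUW, ← add_assoc, ← add_mul]

/-- If the dimension inequality goes the other way, the argument is applied to the complementary
projections. -/
theorem exists_compactEquiv_diagProj {P : H →L[ℂ] H} (hP : P ∈ projections b)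
    (h1 : ¬ IsCompactOperator P) (h2 : ¬ IsCompactOperator (1 - P : H →L[ℂ] H)) :
    ∃ A, CompactEquiv P (diagProj b A) := by
  obtain ⟨B, hB⟩ := exists_isCompactOperator_sub_diagProj b hP
  have hB' : IsCompactOperator (1 - P - diagProj b Bᶜ : H →L[ℂ] H) := by
    rw [← one_sub_diagProj, sub_sub_sub_cancel_left, ← neg_sub]; exact hB.neg
  have hBi : B.Infinite := fun hfin => h1 (by
    have := hB.add ((isCompactOperator_diagProj_iff b).2 hfin)
    rwa [← FunLike.coe_add, sub_add_cancel] at this)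
  have hBi' : Bᶜ.Infinite := fun hfin => h2 (by
    have := hB'.add ((isCompactOperator_diagProj_iff b).2 hfin)
    rwa [← FunLike.coe_add, sub_add_cancel] at this)
  rcases le_total (Module.finrank ℂ (rangeInfKer (diagProj b B) P))
    (Module.finrank ℂ (rangeInfKer P (diagProj b B))) with h | h
  · exact exists_compactEquiv_diagProj_of_finrank_le b hP.1 hB hBi' h
  · obtain ⟨A, hA⟩ := exists_compactEquiv_diagProj_of_finrank_le b hP.1.one_sub hB'
      (by rwa [compl_compl]) (by rwa [← one_sub_diagProj, rangeInfKer_one_sub, rangeInfKer_one_sub])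
    refine ⟨Aᶜ, ?_⟩
    have := hA.one_sub
    rwa [sub_sub_cancel, one_sub_diagProj] at this

theorem compactEquiv_diagProj_of_ncard_eq {A B : Set ℕ} (hA : (A \ B).Finite) (hB : (B \ A).Finite)
    (h : (A \ B).ncard = (B \ A).ncard) : CompactEquiv (diagProj b A) (diagProj b B) := by
  have := finiteDimensional_span_image b hA
  have := finiteDimensional_span_image b hB
  have h1 : ∀ A B : Set ℕ, diagProj b A = diagProj b (A ∩ B) + diagProj b (A \ B) := fun A B => by
    rw [← diagProj_union b Set.disjoint_sdiff_inter.symm, Set.inter_union_sdiff]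
  rw [h1 A B, h1 B A, Set.inter_comm B A, diagProj_eq_starProjection b (A \ B),
    diagProj_eq_starProjection b (B \ A)]
  refine compactEquiv_add_starProjection (isStarProjection_diagProj b _) _ _
    (fun x hx => diagProj_apply_of_mem_span b hx _ Set.disjoint_sdiff_inter.symm)
    (fun x hx => diagProj_apply_of_mem_span b hx _ ?_) ?_
  · rw [Set.inter_comm]; exact Set.disjoint_sdiff_inter.symm
  · rw [finrank_span_image b hA, finrank_span_image b hB, h]

/-- Otherwise `E_B` would be conjugate, through `E_A`, to the projection of `(A ∩ B) ∪ C` with `C` a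
proper subset of `B \ A`; `CompactEquiv.eq_of_mul_eq` excludes such a proper subprojection. -/
theorem ncard_le_of_compactEquiv_diagProj {A B : Set ℕ}
    (h : CompactEquiv (diagProj b A) (diagProj b B)) : (B \ A).ncard ≤ (A \ B).ncard := by
  obtain ⟨hA, hB⟩ := (isCompactOperator_diagProj_sub_iff b).1 h.isCompactOperator_sub
  by_contra! hlt
  obtain ⟨C, hC, hCcard⟩ := Set.exists_subset_card_eq hlt.le
  have hCA : ∀ n ∈ C, n ∉ A := fun n hn => (hC hn).2
  have hCB : ∀ n ∈ C, n ∈ B := fun n hn => (hC hn).1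
  have e1 : A \ (A ∩ B ∪ C) = A \ B := by
    ext n; have := hCA n; simp only [Set.mem_sdiff, Set.mem_union, Set.mem_inter_iff]; tauto
  have e2 : (A ∩ B ∪ C) \ A = C := by
    ext n; have := hCA n; simp only [Set.mem_sdiff, Set.mem_union, Set.mem_inter_iff]; tauto
  have h1 : CompactEquiv (diagProj b A) (diagProj b (A ∩ B ∪ C)) :=
    compactEquiv_diagProj_of_ncard_eq b (by rwa [e1]) (by rw [e2]; exact hB.subset hC)
      (by rw [e1, e2, hCcard])
  have h2 := (h.symm.trans h1).eq_of_mul_eq (isStarProjection_diagProj b _)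
    (isStarProjection_diagProj b _) (by
      rw [diagProj_mul, Set.inter_eq_right.2 (Set.union_subset Set.inter_subset_right hCB)])
  have h3 : C = B \ A := by
    rw [← e2, diagProj_injective b h2]
  rw [h3] at hCcard
  omega

theorem compactEquiv_diagProj_iff {A B : Set ℕ} :
    CompactEquiv (diagProj b A) (diagProj b B) ↔
      (A \ B).Finite ∧ (B \ A).Finite ∧ (A \ B).ncard = (B \ A).ncard := by
  refine ⟨fun h => ?_, fun ⟨hA, hB, h⟩ => compactEquiv_diagProj_of_ncard_eq b hA hB h⟩
  obtain ⟨hA, hB⟩ := (isCompactOperator_diagProj_sub_iff b).1 h.isCompactOperator_sub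
  exact ⟨hA, hB, (ncard_le_of_compactEquiv_diagProj b h.symm).antisymm
    (ncard_le_of_compactEquiv_diagProj b h)⟩

end

/-! ### Rank conditions and the index of diagonal pairs -/

section

variable {H : Type*} [NormedAddCommGroup H] [InnerProductSpace ℂ H]

theorem isCompactOperator_of_finiteDimensional_range {T : H →L[ℂ] H}
    (hT : FiniteDimensional ℂ (LinearMap.range T.toLinearMap)) : IsCompactOperator T := by
  have h : IsCompactOperator (T.codRestrict (LinearMap.range T.toLinearMap) fun x => ⟨x, rfl⟩) :=
    isCompactOperator_of_locallyCompactSpace_dom _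
  exact h.clm_comp (LinearMap.range T.toLinearMap).subtypeL

theorem finiteDimensional_range_iff {P : H →L[ℂ] H} (hP : IsIdempotentElem P) :
    FiniteDimensional ℂ (LinearMap.range P.toLinearMap) ↔ IsCompactOperator P := by
  refine ⟨isCompactOperator_of_finiteDimensional_range, fun h => ?_⟩
  have hPx : ∀ x, P (P x) = P x := fun x => congr($hP x)
  have h1 : LinearMap.range P.toLinearMap = LinearMap.ker (1 - P).toLinearMap := by
    ext x
    simp only [LinearMap.mem_range, LinearMap.mem_ker, ContinuousLinearMap.coe_coe, sub_apply,
      sub_eq_zero]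
    constructor
    · rintro ⟨y, rfl⟩
      exact (hPx y).symm
    · exact fun hx => ⟨x, hx.symm⟩
  refine finiteDimensional_of_isCompactOperator h ?_ ?_
  · rw [h1]; exact (1 - P).isClosed_ker
  · rintro _ ⟨y, rfl⟩
    exact hPx y

theorem finiteDimensional_ker_iff {P : H →L[ℂ] H} (hP : IsIdempotentElem P) :
    FiniteDimensional ℂ (LinearMap.ker P.toLinearMap) ↔
      IsCompactOperator (1 - P : H →L[ℂ] H) := by
  rw [← finiteDimensional_range_iff hP.one_sub]
  have : LinearMap.ker P.toLinearMap = LinearMap.range (1 - P).toLinearMap := by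
    ext x
    simp only [LinearMap.mem_range, LinearMap.mem_ker, ContinuousLinearMap.coe_coe, sub_apply]
    constructor
    · exact fun hx => ⟨x, by simp [hx]⟩
    · rintro ⟨y, rfl⟩
      have : P (P y) = P y := congr($hP y)
      simp [this]
  rw [this]

variable (b : HilbertBasis ℕ ℂ H) [CompleteSpace H]

/-- In this form the rank conditions are visibly stable under compact perturbation. -/
theorem mem_infProjections_iff {P : H →L[ℂ] H} :
    P ∈ infProjections b ↔ P ∈ projections b ∧ ¬ IsCompactOperator P ∧
      ¬ IsCompactOperator (1 - P : H →L[ℂ] H) := by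
  refine and_congr_right fun hP => ?_
  rw [finiteDimensional_range_iff hP.1.isIdempotentElem,
    finiteDimensional_ker_iff hP.1.isIdempotentElem]

theorem diagProj_mem_projections (A : Set ℕ) : diagProj b A ∈ projections b :=
  ⟨isStarProjection_diagProj b A, _, 0, isDiagonal_diagProj b A, isCompactOperator_zero,
    (add_zero _).symm⟩

theorem diagProj_mem_infProjections_iff {A : Set ℕ} :
    diagProj b A ∈ infProjections b ↔ A.Infinite ∧ Aᶜ.Infinite := by
  rw [mem_infProjections_iff, one_sub_diagProj, isCompactOperator_diagProj_iff,
    isCompactOperator_diagProj_iff, and_iff_right (diagProj_mem_projections b A)]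
  rfl

theorem mem_infDiagProjections_iff {E : H →L[ℂ] H} :
    E ∈ infDiagProjections b ↔ ∃ A : Set ℕ, A.Infinite ∧ Aᶜ.Infinite ∧ E = diagProj b A := by
  constructor
  · rintro ⟨hE, hd, h1, h0⟩
    obtain ⟨A, rfl⟩ := exists_eq_diagProj b hE hd
    simp only [diagProj_apply_eq_self_iff, diagProj_apply_eq_zero_iff] at h1 h0
    exact ⟨A, h1, h0, rfl⟩
  · rintro ⟨A, h1, h0, rfl⟩
    refine ⟨isStarProjection_diagProj b A, isDiagonal_diagProj b A, ?_, ?_⟩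
    · convert h1 using 1
      exact Set.ext fun n => diagProj_apply_eq_self_iff b
    · convert h0 using 1
      exact Set.ext fun n => diagProj_apply_eq_zero_iff b

theorem finiteDimensional_range_diagProj_iff {A : Set ℕ} :
    FiniteDimensional ℂ (LinearMap.range (diagProj b A).toLinearMap) ↔ A.Finite := by
  rw [finiteDimensional_range_iff (isStarProjection_diagProj b A).isIdempotentElem,
    isCompactOperator_diagProj_iff]

theorem finrank_range_diagProj {A : Set ℕ} (hA : A.Finite) :
    Module.finrank ℂ (LinearMap.range (diagProj b A).toLinearMap) = A.ncard := by
  have := finiteDimensional_span_image b hA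
  rw [← finrank_span_image b hA, diagProj_eq_starProjection, Submodule.range_starProjection]

theorem diagProj_diagProj_apply (A B : Set ℕ) (x : H) :
    diagProj b A (diagProj b B x) = diagProj b (A ∩ B) x :=
  congr($(diagProj_mul b A B) x)

theorem diagProj_empty_apply (x : H) : diagProj b ∅ x = 0 := by
  have : diagProj b (∅ : Set ℕ) = 0 := ext_hilbertBasis b fun n => by simp [diagProj_apply]
  rw [this]; rfl

theorem diagProj_inter_add_sdiff_apply (A B : Set ℕ) (x : H) :
    diagProj b (A ∩ B) x + diagProj b (A \ B) x = diagProj b A x := by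
  have : diagProj b (A ∩ B) + diagProj b (A \ B) = diagProj b A := by
    rw [← diagProj_union b Set.disjoint_sdiff_inter.symm, Set.inter_union_sdiff]
  exact congr($this x)

theorem mem_range_diagProj {A : Set ℕ} {x : H} :
    x ∈ LinearMap.range (diagProj b A).toLinearMap ↔ diagProj b A x = x := by
  constructor
  · rintro ⟨y, rfl⟩
    change diagProj b A (diagProj b A y) = diagProj b A y
    rw [diagProj_diagProj_apply, Set.inter_self]
  · exact fun h => ⟨x, h⟩

theorem map_ker_pairOperator_diagProj (A B : Set ℕ) :
    (LinearMap.ker (pairOperator (diagProj b A) (diagProj b B)).toLinearMap).map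
      (LinearMap.range (diagProj b A).toLinearMap).subtype
      = LinearMap.range (diagProj b (A \ B)).toLinearMap := by
  ext x
  rw [mem_range_diagProj]
  constructor
  · rintro ⟨⟨y, hy⟩, h0, rfl⟩
    have hy0 : diagProj b B y = 0 := congrArg Subtype.val h0
    rw [mem_range_diagProj] at hy
    change diagProj b (A \ B) y = y
    have h1 := diagProj_inter_add_sdiff_apply b A B y
    rwa [← diagProj_diagProj_apply, hy0, map_zero, zero_add, hy] at h1
  · intro hx
    have h1 : diagProj b A x = x := by
      rw [← hx, diagProj_diagProj_apply, Set.inter_eq_right.2 Set.sdiff_subset]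
    have h2 : diagProj b B x = 0 := by
      rw [← hx, diagProj_diagProj_apply, Set.inter_sdiff_self, diagProj_empty_apply]
    exact ⟨⟨x, (mem_range_diagProj b).2 h1⟩, Subtype.ext h2, rfl⟩

/-- The restriction of a diagonal projection to the range of another one. -/
def diagProjRestrict (B C : Set ℕ) : LinearMap.range (diagProj b B).toLinearMap →ₗ[ℂ] H :=
  (diagProj b C).toLinearMap ∘ₗ (LinearMap.range (diagProj b B).toLinearMap).subtype

theorem range_diagProjRestrict {B C : Set ℕ} (h : C ⊆ B) :
    LinearMap.range (diagProjRestrict b B C) = LinearMap.range (diagProj b C).toLinearMap := by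
  ext x
  constructor
  · rintro ⟨y, rfl⟩
    exact ⟨y, rfl⟩
  · intro hx
    rw [mem_range_diagProj] at hx
    have h1 : diagProj b B x = x := by
      rw [← hx, diagProj_diagProj_apply, Set.inter_eq_right.2 h]
    exact ⟨⟨x, (mem_range_diagProj b).2 h1⟩, hx⟩

/-- Writing the range as a kernel lets the first isomorphism theorem identify the cokernel with the
range of `diagProj b (B \ A)`. -/
theorem range_pairOperator_diagProj (A B : Set ℕ) :
    LinearMap.range (pairOperator (diagProj b A) (diagProj b B)).toLinearMap
      = LinearMap.ker (diagProjRestrict b B (B \ A)) := by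
  ext ⟨y, hy⟩
  rw [LinearMap.mem_ker]
  constructor
  · rintro ⟨⟨z, hz⟩, hzy⟩
    have h1 : diagProj b B z = y := congrArg Subtype.val hzy
    rw [mem_range_diagProj] at hz
    change diagProj b (B \ A) y = 0
    have h2 : (B \ A) ∩ B ∩ A = ∅ := by
      ext n; simp only [Set.mem_inter_iff, Set.mem_sdiff, Set.mem_empty_iff_false]; tauto
    rw [← h1, ← hz, diagProj_diagProj_apply, diagProj_diagProj_apply, h2, diagProj_empty_apply]
  · intro h
    change diagProj b (B \ A) y = 0 at h
    refine ⟨⟨diagProj b A y, y, rfl⟩, Subtype.ext ?_⟩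
    change diagProj b B (diagProj b A y) = y
    have h1 := diagProj_inter_add_sdiff_apply b B A y
    rw [h, add_zero, (mem_range_diagProj b).1 hy] at h1
    rw [diagProj_diagProj_apply, h1]

/-- On `R(E_A)`, the operator `E_A E_B - 1` is `-E_{A \ B}`. Thus the two pair operators are
quasi-inverse when both differences are finite. -/
theorem hasFiniteRange_pairOperator_comp_sub {A B : Set ℕ} (h : (A \ B).Finite) :
    ((pairOperator (diagProj b B) (diagProj b A)).toLinearMap ∘ₗ
      (pairOperator (diagProj b A) (diagProj b B)).toLinearMap - LinearMap.id).HasFiniteRange := by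
  rw [← LinearMap.ker_coFG_iff_hasFiniteRange]
  have h1 : LinearMap.ker ((pairOperator (diagProj b B) (diagProj b A)).toLinearMap ∘ₗ
      (pairOperator (diagProj b A) (diagProj b B)).toLinearMap - LinearMap.id)
      = LinearMap.ker (diagProjRestrict b A (A \ B)) := by
    ext ⟨x, hx⟩
    rw [LinearMap.mem_ker, LinearMap.mem_ker, LinearMap.sub_apply, sub_eq_zero, ← Subtype.coe_inj]
    change diagProj b A (diagProj b B x) = x ↔ diagProj b (A \ B) x = 0
    rw [diagProj_diagProj_apply]
    have h2 := diagProj_inter_add_sdiff_apply b A B x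
    rw [(mem_range_diagProj b).1 hx] at h2
    constructor
    · intro h3
      rw [h3] at h2
      simpa using h2
    · intro h3
      rwa [h3, add_zero] at h2
  rw [h1, LinearMap.ker_coFG_iff_hasFiniteRange, LinearMap.hasFiniteRange_iff_range,
    range_diagProjRestrict b Set.sdiff_subset]
  have := (finiteDimensional_range_diagProj_iff b).2 h
  exact (Submodule.fg_iff_finiteDimensional _).2 this

theorem hasPairIndex_diagProj_iff {A B : Set ℕ} :
    HasPairIndex (diagProj b A) (diagProj b B) 0 ↔
      (A \ B).Finite ∧ (B \ A).Finite ∧ (A \ B).ncard = (B \ A).ncard := by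
  have e1 : LinearMap.ker (pairOperator (diagProj b A) (diagProj b B)).toLinearMap ≃ₗ[ℂ]
      LinearMap.range (diagProj b (A \ B)).toLinearMap :=
    (Submodule.equivSubtypeMap _ _).trans
      (LinearEquiv.ofEq _ _ (map_ker_pairOperator_diagProj b A B))
  have e2 : (LinearMap.range (diagProj b B).toLinearMap ⧸
      LinearMap.range (pairOperator (diagProj b A) (diagProj b B)).toLinearMap) ≃ₗ[ℂ]
      LinearMap.range (diagProj b (B \ A)).toLinearMap :=
    (Submodule.quotEquivOfEq _ _ (range_pairOperator_diagProj b A B)).trans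
      ((LinearMap.quotKerEquivRange _).trans
        (LinearEquiv.ofEq _ _ (range_diagProjRestrict b Set.sdiff_subset)))
  have hindex : (A \ B).Finite → (B \ A).Finite →
      fredholmIndex (pairOperator (diagProj b A) (diagProj b B))
        = (A \ B).ncard - (B \ A).ncard := fun hA hB => by
    rw [fredholmIndex, e1.finrank_eq, e2.finrank_eq, finrank_range_diagProj b hA,
      finrank_range_diagProj b hB]
  constructor
  · rintro ⟨hF, hi⟩
    have hA : (A \ B).Finite := by
      rw [← finiteDimensional_range_diagProj_iff b]
      have := hF.finite_ker
      exact e1.finiteDimensional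
    have hB : (B \ A).Finite := by
      rw [← finiteDimensional_range_diagProj_iff b]
      have := hF.finite_coker
      exact e2.finiteDimensional
    rw [hindex hA hB] at hi
    exact ⟨hA, hB, by omega⟩
  · rintro ⟨hA, hB, h⟩
    refine ⟨?_, by rw [hindex hA hB, h, sub_self]⟩
    refine ContinuousLinearMap.IsFredholm.of_isQuasiInverse
      (v := pairOperator (diagProj b B) (diagProj b A)) ⟨?_, ?_⟩
    · exact LinearMap.FiniteRangeSetoid.equiv_iff_hasFiniteRange.2
        (hasFiniteRange_pairOperator_comp_sub b hA)
    · exact LinearMap.FiniteRangeSetoid.equiv_iff_hasFiniteRange.2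
        (hasFiniteRange_pairOperator_comp_sub b hB)

end

/-! ### Counting subsets of the natural numbers -/

section

section Combinatorics

theorem countable_setOf_finite_sdiff {α : Type*} [Countable α] (A : Set α) :
    {B : Set α | (A \ B).Finite ∧ (B \ A).Finite}.Countable := by
  refine (Set.countable_range
    (fun p : Finset α × Finset α => (A \ (p.1 : Set α)) ∪ (p.2 : Set α))).mono ?_
  rintro B ⟨h1, h2⟩
  refine ⟨(h1.toFinset, h2.toFinset), ?_⟩
  ext n
  simp only [Set.Finite.coe_toFinset, Set.mem_union, Set.mem_sdiff]
  tauto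

theorem not_countable_infinite_infinite_compl :
    ¬ {A : Set ℕ | A.Infinite ∧ Aᶜ.Infinite}.Countable := by
  intro hc
  -- `g s` picks one element from each pair `{2k, 2k + 1}`, the even one iff `k ∈ s`; so it is
  -- infinite and co-infinite and determines `s`.
  let g : Set ℕ → Set ℕ := fun s => {n | n / 2 ∈ s ↔ n % 2 = 0}
  have h0 : ∀ s k, 2 * k ∈ g s ↔ k ∈ s := fun s k => by
    change (2 * k / 2 ∈ s ↔ 2 * k % 2 = 0) ↔ _
    rw [show 2 * k / 2 = k by omega]
    simp
  have h1 : ∀ s k, 2 * k + 1 ∈ g s ↔ k ∉ s := fun s k => by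
    change ((2 * k + 1) / 2 ∈ s ↔ (2 * k + 1) % 2 = 0) ↔ _
    rw [show (2 * k + 1) / 2 = k by omega]
    simp [show (2 * k + 1) % 2 = 1 by omega]
  have hg : ∀ s, g s ∈ {A : Set ℕ | A.Infinite ∧ Aᶜ.Infinite} := by
    intro s
    constructor <;> refine Set.infinite_of_forall_exists_gt fun k => ?_
    · by_cases hk : k + 1 ∈ s
      · exact ⟨2 * (k + 1), (h0 _ _).2 hk, by omega⟩
      · exact ⟨2 * (k + 1) + 1, (h1 _ _).2 hk, by omega⟩
    · by_cases hk : k + 1 ∈ s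
      · exact ⟨2 * (k + 1) + 1, fun h => (h1 _ _).1 h hk, by omega⟩
      · exact ⟨2 * (k + 1), fun h => hk ((h0 _ _).1 h), by omega⟩
  have hinj : Set.InjOn g Set.univ := by
    intro s _ t _ hst
    ext k
    rw [← h0, hst, h0]
  have h2 : (Set.univ : Set (Set ℕ)).Countable :=
    Set.MapsTo.countable_of_injOn (fun s _ => hg s) hinj hc
  have : Countable (Set ℕ) := Set.countable_univ_iff.1 h2
  obtain ⟨f, hf⟩ := exists_surjective_nat (Set ℕ)
  exact Function.cantor_surjective f hf

end Combinatorics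

/-! ### Connected components as conjugacy classes -/

variable {H : Type*} [NormedAddCommGroup H] [InnerProductSpace ℂ H] [CompleteSpace H]

theorem CompactEquiv.eq_conj {P Q : H →L[ℂ] H} (h : CompactEquiv P Q) :
    ∃ U : unitary (H →L[ℂ] H), Q = U * P * star (U : H →L[ℂ] H) := by
  obtain ⟨U, hU, h⟩ := h
  exact ⟨U, by simp [h, mul_assoc]⟩

theorem CompactEquiv.isStarProjection {P Q : H →L[ℂ] H} (h : CompactEquiv P Q)
    (hP : IsStarProjection P) : IsStarProjection Q := by
  obtain ⟨U, rfl⟩ := h.eq_conj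
  constructor
  · change _ * _ = _
    have h1 : star (U : H →L[ℂ] H) * U = 1 := Unitary.coe_star_mul_self U
    have h2 : P * P = P := hP.isIdempotentElem
    calc _ = (U : H →L[ℂ] H) * P * (star (U : H →L[ℂ] H) * U) * P * star (U : H →L[ℂ] H) := by
          noncomm_ring
      _ = _ := by rw [h1, mul_one, mul_assoc (U : H →L[ℂ] H), h2]
  · exact hP.isSelfAdjoint.conjugate _

variable (b : HilbertBasis ℕ ℂ H)

theorem CompactEquiv.mem_projections {P Q : H →L[ℂ] H} (h : CompactEquiv P Q)
    (hP : P ∈ projections b) : Q ∈ projections b := by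
  refine ⟨h.isStarProjection hP.1, ?_⟩
  obtain ⟨-, D, K, hD, hK, rfl⟩ := hP
  have hc := h.symm.isCompactOperator_sub
  exact ⟨D, K + (Q - (D + K)), hD, hK.add hc, by abel⟩

theorem CompactEquiv.mem_infProjections {P Q : H →L[ℂ] H} (h : CompactEquiv P Q)
    (hP : P ∈ infProjections b) : Q ∈ infProjections b := by
  rw [mem_infProjections_iff] at hP ⊢
  refine ⟨h.mem_projections b hP.1, fun hQ => hP.2.1 ?_, fun hQ => hP.2.2 ?_⟩
  · have := h.isCompactOperator_sub.add hQ
    rwa [← FunLike.coe_add, sub_add_cancel] at this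
  · have := h.one_sub.isCompactOperator_sub.add hQ
    rwa [← FunLike.coe_add, sub_add_cancel] at this

/-- An equivalence relation that holds locally holds throughout a preconnected set; locally it comes
from the unit ball around each projection. -/
theorem compactEquiv_of_mem_connectedComponentIn {S : Set (H →L[ℂ] H)} (hS : S ⊆ projections b)
    {P Q : H →L[ℂ] H} (hP : P ∈ S) (hQ : Q ∈ connectedComponentIn S P) : CompactEquiv P Q := by
  have hsub := connectedComponentIn_subset S P
  refine isPreconnected_connectedComponentIn.induction₂ CompactEquiv (fun R hR => ?_)
    (fun _ _ _ _ _ _ => CompactEquiv.trans) (fun _ _ _ _ => CompactEquiv.symm)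
    (mem_connectedComponentIn hP) hQ
  filter_upwards [self_mem_nhdsWithin, mem_nhdsWithin_of_mem_nhds (Metric.ball_mem_nhds R one_pos)]
    with T hT hRT
  rw [Metric.mem_ball, dist_comm, dist_eq_norm] at hRT
  have hR' := hS (hsub hR)
  have hT' := hS (hsub hT)
  exact compactEquiv_of_norm_sub_lt_one hR'.1 hT'.1
    (isCompactOperator_sub_of_norm_lt_one b hR' hT' hRT) hRT

/-- The path `exp(itX) P exp(-itX)` joins the two projections within the orbit of `P`. -/
theorem CompactEquiv.mem_connectedComponentIn {P Q : H →L[ℂ] H} (h : CompactEquiv P Q)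
    (hP : P ∈ infProjections b) : Q ∈ connectedComponentIn (infProjections b) P := by
  have := separableSpace_of_hilbertBasis b
  obtain ⟨_, ⟨X, hX, hXc, rfl⟩, rfl⟩ := mem_compactExpOrbit_iff.2 h
  let γ : ℝ → (H →L[ℂ] H) := fun t =>
    NormedSpace.exp (Complex.I • ((t : ℂ) • X)) * P *
      star (NormedSpace.exp (Complex.I • ((t : ℂ) • X)))
  have hexp : Continuous (NormedSpace.exp : (H →L[ℂ] H) → (H →L[ℂ] H)) := by
    let _ : NormedAlgebra ℚ (H →L[ℂ] H) := .restrictScalars ℚ ℂ _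
    exact NormedSpace.exp_continuous
  have hγ : Continuous γ := by
    have h1 : Continuous fun t : ℝ => NormedSpace.exp (Complex.I • ((t : ℂ) • X)) :=
      hexp.comp (by fun_prop)
    exact (h1.mul continuous_const).mul h1.star
  have hmem : ∀ t, γ t ∈ infProjections b := by
    intro t
    refine CompactEquiv.mem_infProjections b (mem_compactExpOrbit_iff.1 ?_) hP
    refine ⟨_, ⟨(t : ℂ) • X, ?_, hXc.smul _, rfl⟩, rfl⟩
    rw [IsSelfAdjoint, star_smul, hX.star_eq]
    simp
  refine (isPreconnected_range hγ).subset_connectedComponentIn ⟨0, ?_⟩ ?_ ⟨1, ?_⟩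
  · simp [γ]
  · rintro _ ⟨t, rfl⟩
    exact hmem t
  · simp [γ]

theorem connectedComponentIn_infProjections {P : H →L[ℂ] H} (hP : P ∈ infProjections b) :
    connectedComponentIn (infProjections b) P = compactExpOrbit P := by
  have := separableSpace_of_hilbertBasis b
  ext Q
  rw [mem_compactExpOrbit_iff]
  exact ⟨compactEquiv_of_mem_connectedComponentIn b (fun _ h => h.1) hP,
    fun h => h.mem_connectedComponentIn b hP⟩

theorem connectedComponentIn_eq_iff {P Q : H →L[ℂ] H} (hP : P ∈ infProjections b)
    (hQ : Q ∈ infProjections b) :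
    connectedComponentIn (infProjections b) P = connectedComponentIn (infProjections b) Q ↔
      CompactEquiv P Q := by
  refine ⟨fun h => ?_, fun h => connectedComponentIn_eq (h.mem_connectedComponentIn b hP)⟩
  refine compactEquiv_of_mem_connectedComponentIn b (fun _ h => h.1) hP ?_
  rw [h]
  exact _root_.mem_connectedComponentIn hQ

/-- Sets giving the same component have finite symmetric difference, so the map from sets to
components has countable fibres on an uncountable domain. Leaving `S` general covers both families
of projections. -/
theorem not_countable_componentsOf {S : Set (H →L[ℂ] H)} (hS : S ⊆ projections b)
    (hS' : infProjections b ⊆ S) : ¬ (componentsOf S).Countable := by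
  intro hc
  apply not_countable_infinite_infinite_compl
  let φ : Set ℕ → Set (H →L[ℂ] H) := fun A => connectedComponentIn S (diagProj b A)
  have hmem : ∀ A : Set ℕ, A.Infinite ∧ Aᶜ.Infinite → diagProj b A ∈ S := fun A hA =>
    hS' ((diagProj_mem_infProjections_iff b).2 hA)
  have himg : (φ '' {A : Set ℕ | A.Infinite ∧ Aᶜ.Infinite}).Countable := by
    refine hc.mono ?_
    rintro _ ⟨A, hA, rfl⟩
    exact ⟨_, hmem A hA, rfl⟩
  have hsub : {A : Set ℕ | A.Infinite ∧ Aᶜ.Infinite} ⊆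
      ⋃ c ∈ φ '' {A : Set ℕ | A.Infinite ∧ Aᶜ.Infinite},
        {A : Set ℕ | (A.Infinite ∧ Aᶜ.Infinite) ∧ φ A = c} :=
    fun A hA => Set.mem_iUnion₂.2 ⟨φ A, Set.mem_image_of_mem φ hA, hA, rfl⟩
  refine (himg.biUnion ?_).mono hsub
  rintro _ ⟨A, hA, rfl⟩
  refine (countable_setOf_finite_sdiff A).mono ?_
  rintro B ⟨hB, hBA⟩
  have h1 : diagProj b B ∈ connectedComponentIn S (diagProj b A) := by
    change diagProj b B ∈ φ A
    rw [← hBA]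
    exact _root_.mem_connectedComponentIn (hmem B hB)
  have h2 := compactEquiv_of_mem_connectedComponentIn b hS (hmem A hA) h1
  exact (isCompactOperator_diagProj_sub_iff b).1 h2.isCompactOperator_sub

theorem image_infDiagProjections :
    (fun E => connectedComponentIn (infProjections b) E) '' infDiagProjections b
      = componentsOf (infProjections b) := by
  apply Set.Subset.antisymm
  · rintro _ ⟨E, hE, rfl⟩
    obtain ⟨A, h1, h2, rfl⟩ := (mem_infDiagProjections_iff b).1 hE
    exact ⟨_, (diagProj_mem_infProjections_iff b).2 ⟨h1, h2⟩, rfl⟩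
  · rintro _ ⟨P, hP, rfl⟩
    obtain ⟨h0, h1, h2⟩ := (mem_infProjections_iff b).1 hP
    obtain ⟨A, hA⟩ := exists_compactEquiv_diagProj b h0 h1 h2
    have hE := hA.mem_infProjections b hP
    obtain ⟨h3, h4⟩ := (diagProj_mem_infProjections_iff b).1 hE
    exact ⟨diagProj b A, (mem_infDiagProjections_iff b).2 ⟨A, h3, h4, rfl⟩,
      (connectedComponentIn_eq_iff b hE hP).2 hA.symm⟩

end

end DiagPlusCompact

end

theorem mainTheorem2 {H : Type*} [NormedAddCommGroup H] [InnerProductSpace ℂ H]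
    [CompleteSpace H] (b : HilbertBasis ℕ ℂ H) :
    -- `U_∞(H)` is a subgroup of the unitary group of `H`
    (∃ G : Subgroup (unitary (H →L[ℂ] H)),
      (fun U : unitary (H →L[ℂ] H) => (U : H →L[ℂ] H)) '' (G : Set (unitary (H →L[ℂ] H)))
        = DiagPlusCompact.compactExp H) ∧
    -- the components of the set of infinite projections are the orbits of `U_∞(H)`
    (∀ P ∈ DiagPlusCompact.infProjections b,
      connectedComponentIn (DiagPlusCompact.infProjections b) P
        = DiagPlusCompact.compactExpOrbit P) ∧
    -- every diagonal projection defines a component, and all components arise in this way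
    ((fun E => connectedComponentIn (DiagPlusCompact.infProjections b) E) ''
        DiagPlusCompact.infDiagProjections b
      = DiagPlusCompact.componentsOf (DiagPlusCompact.infProjections b)) ∧
    -- two diagonal projections define the same component iff their index is zero
    (∀ E ∈ DiagPlusCompact.infDiagProjections b,
      ∀ E' ∈ DiagPlusCompact.infDiagProjections b,
        (connectedComponentIn (DiagPlusCompact.infProjections b) E
            = connectedComponentIn (DiagPlusCompact.infProjections b) E'
          ↔ DiagPlusCompact.HasPairIndex E E' 0)) ∧
    -- there are uncountably many components
    ¬ (DiagPlusCompact.componentsOf (DiagPlusCompact.infProjections b)).Countable ∧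
    ¬ (DiagPlusCompact.componentsOf (DiagPlusCompact.projections b)).Countable := by
  open DiagPlusCompact in
  have := separableSpace_of_hilbertBasis b
  refine ⟨⟨compactUnitary H, coe_image_compactUnitary⟩,
    fun P hP => connectedComponentIn_infProjections b hP, image_infDiagProjections b, ?_,
    not_countable_componentsOf b (fun _ h => h.1) subset_rfl,
    not_countable_componentsOf b subset_rfl (fun _ h => h.1)⟩
  intro E hE E' hE'
  obtain ⟨A, hA, hA', rfl⟩ := (mem_infDiagProjections_iff b).1 hE
  obtain ⟨B, hB, hB', rfl⟩ := (mem_infDiagProjections_iff b).1 hE'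
  rw [connectedComponentIn_eq_iff b ((diagProj_mem_infProjections_iff b).2 ⟨hA, hA'⟩)
    ((diagProj_mem_infProjections_iff b).2 ⟨hB, hB'⟩), compactEquiv_diagProj_iff,
    hasPairIndex_diagProj_iff]
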